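/- Let $\varphi:\mathbb C^n\to\mathbb R$ be a $\mathcal C^2$-function and let $\eta\in\mathbb R$. Write $\lambda$ for Lebesgue measure on $\mathbb C^n\cong\mathbb R^{2n}$, $z_k=x_k+iy_k$, let $\partial_j$ $(j=1,\dots,2n)$ denote the derivatives with respect to the real coordinates $x_1,\dots,x_n,y_1,\dots,y_n$, and let $L^2(\mathbb C^n,e^{-\varphi})$ be the space of (classes of) measurable functions $h:\mathbb C^n\to\mathbb C$ with $\|h\|_\varphi^2=\int_{\mathbb C^n}|h|^2e^{-\varphi}\,d\lambda<\infty$. Let $$W^1_\eta(\mathbb C^n,e^{-\varphi})=\Big\{h\in L^2(\mathbb C^n,e^{-\varphi}) : \partial_jh-\tfrac{1+\eta}{2}(\partial_j\varphi)h\in L^2(\mathbb C^n,e^{-\varphi}),\ j=1,\dots,2n\Big\},$$ where $\partial_j h$ is taken in the sense of distributions, endowed with the norm $$h\mapsto\Big(\|h\|_\varphi^2+\sum_{j=1}^{2n}\big\|\partial_jh-\tfrac{1+\eta}{2}(\partial_j\varphi)h\big\|_\varphi^2\Big)^{1/2}.$$ Suppose that for some $\epsilon>0$ $$\lim_{|z|\to\infty}\big(\eta^2|\nabla\varphi(z)|^2+(1+\epsilon)\,\eta\,\triangle\varphi(z)\big)=+\infty,\qquad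 |\nabla\varphi|^2=\sum_{k=1}^n\Big(\Big|\frac{\partial\varphi}{\partial x_k}\Big|^2+\Big|\frac{\partial\varphi}{\partial y_k}\Big|^2\Big),$$ where $\triangle=\sum_{k=1}^n\big(\frac{\partial^2}{\partial x_k^2}+\frac{\partial^2}{\partial y_k^2}\big)$. Then the canonical embedding $W^1_\eta(\mathbb C^n,e^{-\varphi})\hookrightarrow L^2(\mathbb C^n,e^{-\varphi})$ is compact. -/

import Mathlib

open MeasureTheory Filter Laplacian
open scoped ContDiff

noncomputable section

namespace WeightedSobolev

/-- The space `ℂⁿ` with its Euclidean norm. -/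
abbrev Cn (n : ℕ) : Type := EuclideanSpace ℂ (Fin n)

/-- The `2n` real coordinate directions of `ℂⁿ`: `Sum.inl k` is the direction of `x_k = Re z_k`,
and `Sum.inr k` is the direction of `y_k = Im z_k`. -/
def coordDir {n : ℕ} : Fin n ⊕ Fin n → Cn n
  | Sum.inl k => EuclideanSpace.single k (1 : ℂ)
  | Sum.inr k => EuclideanSpace.single k Complex.I

/-- The classical partial derivative `∂_j u` in the `j`-th real coordinate direction. -/
def partialD {n : ℕ} {F : Type*} [NormedAddCommGroup F] [NormedSpace ℝ F]
    (j : Fin n ⊕ Fin n) (u : Cn n → F) (z : Cn n) : F :=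
  fderiv ℝ u z (coordDir j)

/-- `|∇φ(z)|² = ∑ₖ (|∂φ/∂xₖ|² + |∂φ/∂yₖ|²)`. -/
def gradSq {n : ℕ} (φ : Cn n → ℝ) (z : Cn n) : ℝ :=
  ∑ k : Fin n, (|partialD (Sum.inl k) φ z| ^ 2 + |partialD (Sum.inr k) φ z| ^ 2)

/-- The measure `e^{-φ} dλ` on `ℂⁿ`, where `λ` is Lebesgue measure. -/
def weight {n : ℕ} (φ : Cn n → ℝ) : Measure (Cn n) :=
  volume.withDensity fun z => ENNReal.ofReal (Real.exp (-φ z))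

/-- The Hilbert space `L²(ℂⁿ, e^{-φ})` of complex-valued functions. -/
abbrev L2 {n : ℕ} (φ : Cn n → ℝ) : Type := Lp ℂ 2 (weight φ)

/-- `∂_j h - ((1 + η) / 2) (∂_j φ) h = g` in the sense of distributions on `ℂⁿ`:
both sides agree on every smooth compactly supported complex-valued test function. -/
def IsTwistedDeriv {n : ℕ} (φ : Cn n → ℝ) (η : ℝ) (j : Fin n ⊕ Fin n) (h g : Cn n → ℂ) : Prop :=
  ∀ ψ : Cn n → ℂ, ContDiff ℝ ∞ ψ → HasCompactSupport ψ →
    -(∫ z, h z * partialD j ψ z)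
        - ∫ z, (((1 + η) / 2 * partialD j φ z : ℝ) : ℂ) * h z * ψ z
      = ∫ z, g z * ψ z

section Helpers

variable {n : ℕ} {φ : Cn n → ℝ}

theorem weight_locallyFinite (hφ : Continuous φ) : IsLocallyFiniteMeasure (weight φ) :=
  IsLocallyFiniteMeasure.withDensity_ofReal (by fun_prop)

/-- Elements of `L²(ℂⁿ, e^{-φ})` may be integrated against continuous functions with compact
support. -/
theorem integrable_mul (hφ : Continuous φ) (h : L2 φ) {ψ : Cn n → ℂ} (hψ : Continuous ψ)
    (hc : HasCompactSupport ψ) : Integrable (fun z => h z * ψ z) := by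
  have := weight_locallyFinite hφ
  have h1 : LocallyIntegrable h (weight φ) := (Lp.memLp h).locallyIntegrable (by norm_num)
  have h2 : Integrable (fun z => ((Real.exp (φ z) : ℂ) * ψ z) • h z) (weight φ) :=
    h1.integrable_smul_left_of_hasCompactSupport
      (by fun_prop) hc.mul_left
  have hm : Measurable fun z => ENNReal.ofReal (Real.exp (-φ z)) := by fun_prop
  have h2 := (integrable_withDensity_iff_integrable_smul' hm (by simp)).mp h2
  refine h2.congr (Eventually.of_forall fun z => ?_)
  have : (Real.exp (-φ z) : ℂ) * (Real.exp (φ z) : ℂ) = 1 := by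
    rw [← Complex.ofReal_mul, ← Real.exp_add]; simp
  simp only [ENNReal.toReal_ofReal (Real.exp_pos _).le, Complex.real_smul, smul_eq_mul]
  linear_combination (ψ z * h z) * this

theorem ae_volume_of_ae_weight (hφ : Continuous φ) {p : Cn n → Prop} (hp : ∀ᵐ z ∂(weight φ), p z) :
    ∀ᵐ z, p z := by
  rw [weight, ae_withDensity_iff (by fun_prop)] at hp
  filter_upwards [hp] with z hz
  exact hz (by simp [Real.exp_pos])

theorem continuous_partialD {F : Type*} [NormedAddCommGroup F] [NormedSpace ℝ F]
    {u : Cn n → F} (hu : ContDiff ℝ 1 u) (j : Fin n ⊕ Fin n) : Continuous (partialD j u) :=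
  (hu.continuous_fderiv (by norm_num)).clm_apply continuous_const

theorem integrable_test₁ (hφ : ContDiff ℝ 2 φ) (h : L2 φ) (j : Fin n ⊕ Fin n) {ψ : Cn n → ℂ}
    (hψ : ContDiff ℝ ∞ ψ) (hc : HasCompactSupport ψ) :
    Integrable (fun z => h z * partialD j ψ z) :=
  integrable_mul hφ.continuous h (continuous_partialD (hψ.of_le (by norm_cast)) j)
    (hc.fderiv_apply (𝕜 := ℝ) (coordDir j))

theorem integrable_test₂ (hφ : ContDiff ℝ 2 φ) (η : ℝ) (h : L2 φ) (j : Fin n ⊕ Fin n)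
    {ψ : Cn n → ℂ} (hψ : ContDiff ℝ ∞ ψ) (hc : HasCompactSupport ψ) :
    Integrable (fun z => (((1 + η) / 2 * partialD j φ z : ℝ) : ℂ) * h z * ψ z) := by
  have hd : Continuous (partialD j φ) := continuous_partialD (hφ.of_le (by norm_num)) j
  have hψ' := hψ.continuous
  refine (integrable_mul hφ.continuous h
    (ψ := fun z => (((1 + η) / 2 * partialD j φ z : ℝ) : ℂ) * ψ z) (by fun_prop) hc.mul_left).congr
    (Eventually.of_forall fun z => ?_)
  simp only
  ring

theorem isTwistedDeriv_add (hφ : ContDiff ℝ 2 φ) (η : ℝ) (j : Fin n ⊕ Fin n) {h g h' g' : L2 φ}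
    (H : IsTwistedDeriv φ η j h g) (H' : IsTwistedDeriv φ η j h' g') :
    IsTwistedDeriv φ η j ↑↑(h + h') ↑↑(g + g') := by
  intro ψ hψ hc
  have e1 := ae_volume_of_ae_weight hφ.continuous (Lp.coeFn_add h h')
  have e2 := ae_volume_of_ae_weight hφ.continuous (Lp.coeFn_add g g')
  have a1 : ∫ z, (h + h' : L2 φ) z * partialD j ψ z
      = (∫ z, h z * partialD j ψ z) + ∫ z, h' z * partialD j ψ z := by
    rw [← integral_add (integrable_test₁ hφ h j hψ hc) (integrable_test₁ hφ h' j hψ hc)]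
    refine integral_congr_ae ?_
    filter_upwards [e1] with z hz
    rw [hz, Pi.add_apply]; ring
  have a2 : ∫ z, (((1 + η) / 2 * partialD j φ z : ℝ) : ℂ) * (h + h' : L2 φ) z * ψ z
      = (∫ z, (((1 + η) / 2 * partialD j φ z : ℝ) : ℂ) * h z * ψ z)
        + ∫ z, (((1 + η) / 2 * partialD j φ z : ℝ) : ℂ) * h' z * ψ z := by
    rw [← integral_add (integrable_test₂ hφ η h j hψ hc) (integrable_test₂ hφ η h' j hψ hc)]
    refine integral_congr_ae ?_
    filter_upwards [e1] with z hz
    rw [hz, Pi.add_apply]; ring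
  have a3 : ∫ z, (g + g' : L2 φ) z * ψ z = (∫ z, g z * ψ z) + ∫ z, g' z * ψ z := by
    rw [← integral_add (integrable_mul hφ.continuous g hψ.continuous hc)
      (integrable_mul hφ.continuous g' hψ.continuous hc)]
    refine integral_congr_ae ?_
    filter_upwards [e2] with z hz
    rw [hz, Pi.add_apply]; ring
  rw [a1, a2, a3, ← H ψ hψ hc, ← H' ψ hψ hc]
  ring

theorem isTwistedDeriv_smul (hφ : ContDiff ℝ 2 φ) (η : ℝ) (j : Fin n ⊕ Fin n) (c : ℂ) {h g : L2 φ}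
    (H : IsTwistedDeriv φ η j h g) : IsTwistedDeriv φ η j ↑↑(c • h) ↑↑(c • g) := by
  intro ψ hψ hc
  have e1 := ae_volume_of_ae_weight hφ.continuous (Lp.coeFn_smul c h)
  have e2 := ae_volume_of_ae_weight hφ.continuous (Lp.coeFn_smul c g)
  have a1 : ∫ z, (c • h : L2 φ) z * partialD j ψ z = c * ∫ z, h z * partialD j ψ z := by
    rw [← integral_const_mul]
    refine integral_congr_ae ?_
    filter_upwards [e1] with z hz
    rw [hz, Pi.smul_apply, smul_eq_mul]; ring
  have a2 : ∫ z, (((1 + η) / 2 * partialD j φ z : ℝ) : ℂ) * (c • h : L2 φ) z * ψ z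
      = c * ∫ z, (((1 + η) / 2 * partialD j φ z : ℝ) : ℂ) * h z * ψ z := by
    rw [← integral_const_mul]
    refine integral_congr_ae ?_
    filter_upwards [e1] with z hz
    rw [hz, Pi.smul_apply, smul_eq_mul]; ring
  have a3 : ∫ z, (c • g : L2 φ) z * ψ z = c * ∫ z, g z * ψ z := by
    rw [← integral_const_mul]
    refine integral_congr_ae ?_
    filter_upwards [e2] with z hz
    rw [hz, Pi.smul_apply, smul_eq_mul]; ring
  rw [a1, a2, a3, ← H ψ hψ hc]
  ring

theorem isTwistedDeriv_zero (hφ : ContDiff ℝ 2 φ) (η : ℝ) (j : Fin n ⊕ Fin n) :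
    IsTwistedDeriv φ η j ↑↑(0 : L2 φ) ↑↑(0 : L2 φ) := by
  intro ψ hψ hc
  have e := ae_volume_of_ae_weight hφ.continuous (Lp.coeFn_zero ℂ 2 (weight φ))
  rw [integral_eq_zero_of_ae, integral_eq_zero_of_ae, integral_eq_zero_of_ae]
  · simp
  all_goals
    filter_upwards [e] with z hz
    rw [hz]
    simp

/-- The distributional `∂_j h - ((1 + η) / 2) (∂_j φ) h` is unique as an element of `L²`. -/
theorem isTwistedDeriv_unique (hφ : ContDiff ℝ 2 φ) (η : ℝ) (j : Fin n ⊕ Fin n) {h g g' : L2 φ}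
    (H : IsTwistedDeriv φ η j h g) (H' : IsTwistedDeriv φ η j h g') : g = g' := by
  have := weight_locallyFinite hφ.continuous
  have key : ∀ f : L2 φ, ∀ u : Cn n → ℝ,
      ∫ z, u z • (Real.exp (φ z) • f z) ∂(weight φ) = ∫ z, f z * (u z : ℂ) := by
    intro f u
    have hm : Measurable fun z => ENNReal.ofReal (Real.exp (-φ z)) := by
      have := hφ.continuous
      fun_prop
    refine (integral_withDensity_eq_integral_toReal_smul hm (by simp) _).trans ?_
    refine integral_congr_ae (Eventually.of_forall fun z => ?_)
    have e : Real.exp (-φ z) * Real.exp (φ z) = 1 := by rw [← Real.exp_add]; simp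
    have e' : (Real.exp (-φ z) : ℂ) * (Real.exp (φ z) : ℂ) = 1 := by
      rw [← Complex.ofReal_mul, e, Complex.ofReal_one]
    simp only [ENNReal.toReal_ofReal (Real.exp_pos _).le, Complex.real_smul]
    linear_combination (u z * f z) * e'
  have hloc : ∀ f : L2 φ, LocallyIntegrable (fun z => Real.exp (φ z) • f z) (weight φ) := by
    intro f
    have hf : LocallyIntegrable f (weight φ) := (Lp.memLp f).locallyIntegrable (by norm_num)
    have hcont : Continuous fun z => Real.exp (φ z) := by
      have := hφ.continuous
      fun_prop
    exact hf.continuous_smul hcont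
  have hae := ae_eq_of_integral_contDiff_smul_eq (hloc g) (hloc g') (by
    intro u hu hc
    rw [key, key]
    have hψ : ContDiff ℝ ∞ fun z => (u z : ℂ) := Complex.ofRealCLM.contDiff.comp hu
    have hcψ : HasCompactSupport fun z => (u z : ℂ) := hc.comp_left Complex.ofReal_zero
    rw [← H _ hψ hcψ, ← H' _ hψ hcψ])
  refine Lp.ext ?_
  filter_upwards [hae] with z hz
  exact smul_right_injective ℂ (Real.exp_pos (φ z)).ne' hz

end Helpers

/-- The set of all `h ∈ L²(ℂⁿ, e^{-φ})` such that, in the sense of distributions,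
`∂_j h - ((1 + η) / 2) (∂_j φ) h ∈ L²(ℂⁿ, e^{-φ})` for all `2n` real directions `j`. -/
def W1Submodule {n : ℕ} {φ : Cn n → ℝ} (hφ : ContDiff ℝ 2 φ) (η : ℝ) : Submodule ℂ (L2 φ) where
  carrier := {h | ∀ j, ∃ g : L2 φ, IsTwistedDeriv φ η j h g}
  add_mem' := fun {h h'} H H' j => by
    obtain ⟨g, hg⟩ := H j
    obtain ⟨g', hg'⟩ := H' j
    exact ⟨g + g', isTwistedDeriv_add hφ η j hg hg'⟩
  zero_mem' := fun j => ⟨0, isTwistedDeriv_zero hφ η j⟩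
  smul_mem' := fun c h H j => by
    obtain ⟨g, hg⟩ := H j
    exact ⟨c • g, isTwistedDeriv_smul hφ η j c hg⟩

/-- The weighted Sobolev space `W¹_η(ℂⁿ, e^{-φ})`. It is a separate type because it carries its
own norm, not the one of `L²(ℂⁿ, e^{-φ})`. -/
def W1 {n : ℕ} {φ : Cn n → ℝ} (hφ : ContDiff ℝ 2 φ) (η : ℝ) : Type := W1Submodule hφ η

section Norm

variable {n : ℕ} {φ : Cn n → ℝ} (hφ : ContDiff ℝ 2 φ) (η : ℝ)

instance : AddCommGroup (W1 hφ η) := inferInstanceAs (AddCommGroup (W1Submodule hφ η))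

instance : Module ℂ (W1 hφ η) := inferInstanceAs (Module ℂ (W1Submodule hφ η))

/-- The inclusion of `W¹_η(ℂⁿ, e^{-φ})` into `L²(ℂⁿ, e^{-φ})` as a linear map. -/
def inclₗ : W1 hφ η →ₗ[ℂ] L2 φ := (W1Submodule hφ η).subtype

/-- `h ↦ ∂_j h - ((1 + η) / 2) (∂_j φ) h`, as a linear map from `W¹_η(ℂⁿ, e^{-φ})` to
`L²(ℂⁿ, e^{-φ})`. In the direction `x_k` this is `X_k`, in the direction `y_k` it is `Y_k`. -/
def twistedD (j : Fin n ⊕ Fin n) : W1 hφ η →ₗ[ℂ] L2 φ where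
  toFun h := (h.2 j).choose
  map_add' h h' := isTwistedDeriv_unique hφ η j ((h + h').2 j).choose_spec
    (isTwistedDeriv_add hφ η j (h.2 j).choose_spec (h'.2 j).choose_spec)
  map_smul' c h := isTwistedDeriv_unique hφ η j ((c • h).2 j).choose_spec
    (isTwistedDeriv_smul hφ η j c (h.2 j).choose_spec)

theorem twistedD_spec (j : Fin n ⊕ Fin n) (h : W1 hφ η) :
    IsTwistedDeriv φ η j (inclₗ hφ η h) (twistedD hφ η j h) :=
  (h.2 j).choose_spec

/-- `h ↦ (h, (∂_j h - ((1 + η) / 2) (∂_j φ) h)_j)`, with values in a Hilbert sum of copies of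
`L²(ℂⁿ, e^{-φ})`. -/
def jet : W1 hφ η →ₗ[ℂ] WithLp 2 (L2 φ × PiLp 2 fun _ : Fin n ⊕ Fin n => L2 φ) where
  toFun h := WithLp.toLp 2 (inclₗ hφ η h, WithLp.toLp 2 fun j => twistedD hφ η j h)
  map_add' h h' := by simp only [map_add]; rfl
  map_smul' c h := by simp only [map_smul]; rfl

theorem jet_injective : Function.Injective (jet hφ η) := fun _ _ h =>
  Subtype.ext (congrArg (fun x => x.fst) h)

/-- The norm `(‖h‖² + ∑_j ‖∂_j h - ((1 + η) / 2) (∂_j φ) h‖²)^{1/2}`; see `norm_eq`. -/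
instance : NormedAddCommGroup (W1 hφ η) :=
  NormedAddCommGroup.induced _ _ (jet hφ η) (jet_injective hφ η)

instance : NormedSpace ℂ (W1 hφ η) := NormedSpace.induced ℂ _ _ (jet hφ η)

theorem norm_eq (h : W1 hφ η) :
    ‖h‖ = √(‖inclₗ hφ η h‖ ^ 2 + ∑ j, ‖twistedD hφ η j h‖ ^ 2) := by
  have h1 : ‖h‖ = ‖jet hφ η h‖ := rfl
  rw [h1, ← Real.sqrt_sq (norm_nonneg (jet hφ η h)), WithLp.prod_norm_sq_eq_of_L2,
    PiLp.norm_sq_eq_of_L2]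
  rfl

/-- The canonical embedding of `W¹_η(ℂⁿ, e^{-φ})` into `L²(ℂⁿ, e^{-φ})`. -/
def embedding : W1 hφ η →L[ℂ] L2 φ :=
  (inclₗ hφ η).mkContinuous 1 fun h => by
    rw [one_mul, norm_eq]
    exact Real.le_sqrt_of_sq_le (le_add_of_nonneg_right (by positivity))

end Norm

end WeightedSobolev

end

/-! Growth of the potential `η² |∇φ|² + (1 + ε) η △φ` makes the mass of `h` near infinity uniformly
small on the unit ball of `W¹_η`. On bounded sets compactness is Rellich's theorem. The embedding is
therefore a limit of compact operators in operator norm.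

Tails. Let `u` be `C¹` with compact support, `X_j = η ∂_jφ` and `D_j u = ∂_j u - (X_j / 2) u`. Since
`∂_j |u|² = 2 Re⟨u, D_j u⟩ + X_j |u|²`, integrating `∂_j (X_j |u|²)` gives `∫ (η ∂_j²φ + X_j²) |u|²
+ 2 X_j Re⟨u, D_j u⟩ = 0`. Multiplying by `1 + ε` leaves a surplus `ε X_j² |u|²` that absorbs the
cross term, so `∫ potential · |u|² ≤ ((1 + ε)² / ε) ∑ ‖D_j u‖²` (`integral_potential_mul_le`). With
`u = e^{-φ/2} χ v`, `D_j` becomes the twisted derivative of `v` in the weighted norm, up to a term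
containing `∂_jχ` (`partialD_conj_weight`). Mollification extends this to weak derivatives, and
cutoffs with uniformly bounded gradient give `exists_tail_bound`.

Bounded sets. There the weight is harmless. The `L²` translation bound for functions with weak
derivatives shows that `h` is close to its means over balls of radius `δ`
(`eLpNorm_sub_average_le`). If the centres are restricted to finitely many points, taking means is
an operator of finite rank (`exists_compact_averaging`). Together, `exists_compact_approx` and the
tail bound give the theorem. -/

noncomputable section

open scoped ENNReal NNReal Topology Convolution

namespace WeightedSobolev

/-! ### Square-integral tools and mollification of weakly differentiable functions. -/

variable {n : ℕ}

/-- Jensen's inequality for the square of the norm. -/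
theorem enorm_integral_sq_le {α F : Type*} [MeasurableSpace α] [NormedAddCommGroup F]
    [NormedSpace ℝ F] {ν : Measure α} [IsProbabilityMeasure ν]
    {g : α → F} (hg : AEStronglyMeasurable g ν) :
    ‖∫ x, g x ∂ν‖ₑ ^ 2 ≤ ∫⁻ x, ‖g x‖ₑ ^ 2 ∂ν := by
  have h1 : ‖∫ x, g x ∂ν‖ₑ ≤ eLpNorm g 2 ν :=
    (enorm_integral_le_lintegral_enorm g).trans <| by
      rw [← eLpNorm_one_eq_lintegral_enorm]
      exact eLpNorm_le_eLpNorm_of_exponent_le (by norm_num) hg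
  calc ‖∫ x, g x ∂ν‖ₑ ^ 2 ≤ eLpNorm g 2 ν ^ 2 := by gcongr
    _ = _ := by
      simpa using eLpNorm_nnreal_pow_eq_lintegral (f := g) (μ := ν) (p := 2) (by norm_num)

theorem eLpNorm_two_sq {α F : Type*} [MeasurableSpace α] [NormedAddCommGroup F]
    (g : α → F) (ν : Measure α) : eLpNorm g 2 ν ^ 2 = ∫⁻ x, ‖g x‖ₑ ^ 2 ∂ν := by
  simpa using eLpNorm_nnreal_pow_eq_lintegral (f := g) (μ := ν) (p := 2) (by norm_num)

theorem eLpNorm_two_le_of_lintegral_sq_le {α F : Type*} [MeasurableSpace α] [NormedAddCommGroup F]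
    {g : α → F} {ν : Measure α} {c : ℝ≥0∞} (h : ∫⁻ x, ‖g x‖ₑ ^ 2 ∂ν ≤ c ^ 2) :
    eLpNorm g 2 ν ≤ c := by
  rw [← eLpNorm_two_sq] at h
  exact (ENNReal.pow_le_pow_left_iff two_ne_zero).1 h

/-- Translation is continuous in `L²`. -/
theorem exists_eLpNorm_translate_sub_le {f : Cn n → ℂ} (hf : MemLp f 2 volume) {ε : ℝ≥0∞}
    (hε : 0 < ε) :
    ∃ δ > 0, ∀ k : Cn n, ‖k‖ < δ → eLpNorm (fun x => f (x - k) - f x) 2 volume ≤ ε := by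
  have hmp : ∀ k : Cn n, MeasurePreserving (fun x : Cn n => x - k) volume volume :=
    fun k => measurePreserving_sub_right volume k
  let g : C(Cn n, C(Cn n, Cn n)) :=
    ContinuousMap.curry ⟨fun p => p.2 - p.1, by fun_prop⟩
  have hc : Continuous fun k : Cn n => Lp.compMeasurePreserving (g k) (hmp k) (hf.toLp f) :=
    Continuous.compMeasurePreservingLp continuous_const g.continuous (fun k => hmp k) (by simp)
  have h0 := hc.tendsto 0
  rw [EMetric.tendsto_nhds_nhds] at h0
  obtain ⟨δ, hδ, H⟩ := h0 ε hε
  -- The modulus `δ` is an extended number, possibly infinite; a finite positive one below it is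
  -- needed.
  obtain ⟨δ', hδ', hlt⟩ := ENNReal.lt_iff_exists_nnreal_btwn.1 hδ
  refine ⟨δ', by exact_mod_cast hδ', fun k hk => ?_⟩
  have hk' : edist k 0 < δ := by
    refine lt_of_le_of_lt ?_ hlt
    rw [edist_zero_right, enorm_le_coe]
    exact_mod_cast hk.le
  have := (H hk').le
  have := (Lp.edist_toLp_toLp _ _ (hf.comp_measurePreserving (hmp k))
    (hf.comp_measurePreserving (hmp 0))).symm.trans_le this
  refine le_of_eq_of_le (congrArg (fun u => eLpNorm u 2 volume) ?_) this
  ext x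
  simp

/-- A bump function normalized to integral one, with complex values. -/
def mollifier (ρ : ContDiffBump (0 : Cn n)) (x : Cn n) : ℂ := (ρ.normed volume x : ℂ)

theorem contDiff_mollifier (ρ : ContDiffBump (0 : Cn n)) : ContDiff ℝ ∞ (mollifier ρ) :=
  Complex.ofRealCLM.contDiff.comp ρ.contDiff_normed

theorem hasCompactSupport_mollifier (ρ : ContDiffBump (0 : Cn n)) :
    HasCompactSupport (mollifier ρ) :=
  ρ.hasCompactSupport_normed.comp_left Complex.ofReal_zero

theorem normed_eq_zero (ρ : ContDiffBump (0 : Cn n)) {x : Cn n} (hx : ρ.rOut ≤ ‖x‖) :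
    ρ.normed volume x = 0 := by
  have : x ∉ Function.support (ρ.normed volume) := by
    rw [ρ.support_normed_eq]; simpa using hx
  exact Function.notMem_support.1 this

theorem mollifier_eq_zero (ρ : ContDiffBump (0 : Cn n)) {x : Cn n} (hx : ρ.rOut ≤ ‖x‖) :
    mollifier ρ x = 0 := by
  rw [mollifier, normed_eq_zero ρ hx, Complex.ofReal_zero]

/-- Convolution with a normalized bump function. -/
def mollify (ρ : ContDiffBump (0 : Cn n)) (f : Cn n → ℂ) : Cn n → ℂ :=
  f ⋆[ContinuousLinearMap.mul ℝ ℂ, volume] mollifier ρ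

theorem mollify_apply (ρ : ContDiffBump (0 : Cn n)) (f : Cn n → ℂ) (x : Cn n) :
    mollify ρ f x = ∫ t, f t * mollifier ρ (x - t) := rfl

theorem mollify_congr (ρ : ContDiffBump (0 : Cn n)) {f g : Cn n → ℂ} (h : f =ᵐ[volume] g) :
    mollify ρ f = mollify ρ g := by
  ext x
  rw [mollify_apply, mollify_apply]
  refine integral_congr_ae ?_
  filter_upwards [h] with t ht
  rw [ht]

theorem contDiff_mollify (ρ : ContDiffBump (0 : Cn n)) {f : Cn n → ℂ}
    (hf : LocallyIntegrable f volume) : ContDiff ℝ ∞ (mollify ρ f) :=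
  (hasCompactSupport_mollifier ρ).contDiff_convolution_right _ hf (contDiff_mollifier ρ)

theorem partialD_mollify (ρ : ContDiffBump (0 : Cn n)) {f : Cn n → ℂ}
    (hf : LocallyIntegrable f volume) (j : Fin n ⊕ Fin n) (x : Cn n) :
    partialD j (mollify ρ f) x = ∫ t, f t * partialD j (mollifier ρ) (x - t) := by
  have h1 : ContDiff ℝ 1 (mollifier ρ) := (contDiff_mollifier ρ).of_le (by norm_cast)
  have := (hasCompactSupport_mollifier ρ).hasFDerivAt_convolution_right
    (ContinuousLinearMap.mul ℝ ℂ) hf h1 x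
  rw [partialD, mollify, this.fderiv, convolution_precompR_apply _ hf
    ((hasCompactSupport_mollifier ρ).fderiv ℝ) (h1.continuous_fderiv one_ne_zero)]
  rfl

/-- The error `mollify ρ f x - f x` is the mean of `f (x - k) - f x` over `k` for the probability
measure with density `ρ`, which charges only `‖k‖ < ρ.rOut`. Jensen and Tonelli reduce its norm to
those of the single translates. -/
theorem eLpNorm_mollify_sub_le (ρ : ContDiffBump (0 : Cn n)) {f : Cn n → ℂ}
    (hf : MemLp f 2 volume) {ε : ℝ≥0∞}
    (h : ∀ k : Cn n, ‖k‖ < ρ.rOut → eLpNorm (fun x => f (x - k) - f x) 2 volume ≤ ε) :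
    eLpNorm (fun x => mollify ρ f x - f x) 2 volume ≤ ε := by
  -- Tonelli needs joint measurability in `(x, k)`, which a strongly measurable representative
  -- provides.
  wlog hm : StronglyMeasurable f generalizing f
  · obtain ⟨g, hg, hfg⟩ := hf.1
    have hsub : ∀ k : Cn n, (fun x => f (x - k)) =ᵐ[volume] fun x => g (x - k) := fun k =>
      (measurePreserving_sub_right volume k).quasiMeasurePreserving.ae_eq_comp hfg
    have := this (hf.ae_eq hfg) (fun k hk => ?_) hg
    · rw [mollify_congr ρ hfg]
      refine le_of_eq_of_le (eLpNorm_congr_ae ?_) this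
      filter_upwards [hfg] with x hx
      rw [hx]
    · refine le_of_eq_of_le (eLpNorm_congr_ae ?_) (h k hk)
      filter_upwards [hfg, hsub k] with x hx hx'
      rw [hx, hx']
  set d : Cn n → ℝ≥0∞ := fun k => ENNReal.ofReal (ρ.normed volume k) with hd
  have hdm : Measurable d := ρ.continuous_normed.measurable.ennreal_ofReal
  set ν : Measure (Cn n) := volume.withDensity d with hν
  have hνp : IsProbabilityMeasure ν := by
    constructor
    rw [hν, withDensity_apply _ MeasurableSet.univ, Measure.restrict_univ, hd,
      ← ofReal_integral_eq_lintegral_ofReal ρ.integrable_normed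
        (Eventually.of_forall ρ.nonneg_normed), ρ.integral_normed, ENNReal.ofReal_one]
  have hint : ∀ u : Cn n → ℂ, ∫ k, u k ∂ν = ∫ k, u k * mollifier ρ k := by
    intro u
    rw [hν, integral_withDensity_eq_integral_toReal_smul hdm (by simp [hd])]
    refine integral_congr_ae (Eventually.of_forall fun k => ?_)
    simp only [hd, ENNReal.toReal_ofReal (ρ.nonneg_normed k), Complex.real_smul, mollifier]
    ring
  have hintg : ∀ x, Integrable (fun k => f (x - k)) ν := by
    intro x
    rw [hν, integrable_withDensity_iff_integrable_smul' hdm (by simp [hd])]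
    have h1 : ConvolutionExistsAt f (mollifier ρ) x (ContinuousLinearMap.mul ℝ ℂ) volume :=
      (hasCompactSupport_mollifier ρ).convolutionExists_right _
        (hf.locallyIntegrable (by norm_num)) (contDiff_mollifier ρ).continuous x
    have h2 := h1.integrable_swap
    refine h2.congr (Eventually.of_forall fun k => ?_)
    simp only [hd, ENNReal.toReal_ofReal (ρ.nonneg_normed k), Complex.real_smul, mollifier,
      ContinuousLinearMap.mul_apply']
    ring
  have hrep : ∀ x, mollify ρ f x - f x = ∫ k, (f (x - k) - f x) ∂ν := by
    intro x
    rw [integral_sub (hintg x) (integrable_const _), integral_const, hint, mollify_apply,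
      ← integral_sub_left_eq_self _ volume x]
    simp
  refine eLpNorm_two_le_of_lintegral_sq_le ?_
  have hm2 : Measurable fun p : Cn n × Cn n => ‖f (p.1 - p.2) - f p.1‖ₑ ^ 2 := by
    have := hm.measurable
    fun_prop
  calc ∫⁻ x, ‖mollify ρ f x - f x‖ₑ ^ 2
      ≤ ∫⁻ x, ∫⁻ k, ‖f (x - k) - f x‖ₑ ^ 2 ∂ν := by
        refine lintegral_mono fun x => ?_
        rw [hrep]
        refine enorm_integral_sq_le ?_
        exact ((hintg x).sub (integrable_const _)).aestronglyMeasurable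
    _ = ∫⁻ k, ∫⁻ x, ‖f (x - k) - f x‖ₑ ^ 2 ∂volume ∂ν := lintegral_lintegral_swap hm2.aemeasurable
    _ ≤ ∫⁻ k, ε ^ 2 ∂ν := by
        refine lintegral_mono_ae ?_
        have hball : ∀ᵐ k ∂ν, ‖k‖ < ρ.rOut := by
          rw [hν, ae_withDensity_iff hdm]
          refine Eventually.of_forall fun k hk => ?_
          by_contra! hle
          exact hk (by simp [hd, normed_eq_zero ρ hle])
        filter_upwards [hball] with k hk
        rw [← eLpNorm_two_sq]
        gcongr
        exact h k hk
    _ = ε ^ 2 := by simp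

/-- `h` has the weak partial derivatives `H j`, where both are locally square integrable. -/
structure HasWeakPartials (h : Cn n → ℂ) (H : Fin n ⊕ Fin n → Cn n → ℂ) : Prop where
  memLp : ∀ R : ℝ, MemLp h 2 (volume.restrict (Metric.closedBall 0 R))
  memLp_partial : ∀ j, ∀ R : ℝ, MemLp (H j) 2 (volume.restrict (Metric.closedBall 0 R))
  integral_eq : ∀ j, ∀ ψ : Cn n → ℂ, ContDiff ℝ ∞ ψ → HasCompactSupport ψ →
    ∫ z, h z * partialD j ψ z = -∫ z, H j z * ψ z

theorem partialD_comp_sub {ψ : Cn n → ℂ} (hψ : Differentiable ℝ ψ) (j : Fin n ⊕ Fin n)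
    (x t : Cn n) : partialD j (fun t => ψ (x - t)) t = -partialD j ψ (x - t) := by
  have h1 : HasFDerivAt (fun t : Cn n => x - t) (-ContinuousLinearMap.id ℝ (Cn n)) t :=
    (hasFDerivAt_id t).const_sub x
  have h2 := (hψ (x - t)).hasFDerivAt.comp t h1
  simp only [partialD]
  change fderiv ℝ (ψ ∘ fun t => x - t) t (coordDir j) = _
  rw [h2.fderiv]
  simp

/-- Functions with locally square integrable weak derivatives are approximated by smooth functions
on every ball. -/
theorem HasWeakPartials.exists_smooth_approx {h : Cn n → ℂ} {H : Fin n ⊕ Fin n → Cn n → ℂ}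
    (hh : HasWeakPartials h H) (R : ℝ) {ε : ℝ≥0∞} (hε : 0 < ε) :
    ∃ v : Cn n → ℂ, ContDiff ℝ ∞ v ∧
      eLpNorm (fun x => v x - h x) 2 (volume.restrict (Metric.closedBall 0 R)) ≤ ε ∧
      ∀ j, eLpNorm (fun x => partialD j v x - H j x) 2
        (volume.restrict (Metric.closedBall 0 R)) ≤ ε := by
  -- Truncating to `B` gives global `L²` functions. Since the mollification radius is at most `1`,
  -- values on the ball of radius `R` do not see the truncation.
  set B : Set (Cn n) := Metric.closedBall 0 (R + 1) with hB
  have hBm : MeasurableSet B := Metric.isClosed_closedBall.measurableSet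
  have hf : MemLp (B.indicator h) 2 volume := (memLp_indicator_iff_restrict hBm).2 (hh.memLp _)
  have hF : ∀ j, MemLp (B.indicator (H j)) 2 volume := fun j =>
    (memLp_indicator_iff_restrict hBm).2 (hh.memLp_partial j _)
  obtain ⟨δ₀, hδ₀, h₀⟩ := exists_eLpNorm_translate_sub_le hf hε
  choose δ hδ h₁ using fun j => exists_eLpNorm_translate_sub_le (hF j) hε
  obtain ⟨r, hr0, hr1, hr2, hr3⟩ : ∃ r : ℝ, 0 < r ∧ r ≤ 1 ∧ r ≤ δ₀ ∧ ∀ j, r ≤ δ j := by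
    have hev : ∀ᶠ r in 𝓝[>] (0 : ℝ), 0 < r ∧ r ≤ 1 ∧ r ≤ δ₀ ∧ ∀ j, r ≤ δ j := by
      have hle : ∀ c : ℝ, 0 < c → ∀ᶠ r in 𝓝[>] (0 : ℝ), r ≤ c := fun c hc =>
        nhdsWithin_le_nhds (Iic_mem_nhds hc)
      exact (eventually_mem_nhdsWithin).and ((hle 1 one_pos).and
        ((hle _ hδ₀).and (eventually_all.2 fun j => hle _ (hδ j))))
    exact hev.exists
  let ρ : ContDiffBump (0 : Cn n) := ⟨r / 2, r, by positivity, by linarith⟩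
  have hloc := hf.locallyIntegrable (μ := volume) (by norm_num)
  have hsub : ∀ (f g u : Cn n → ℂ), (∀ x ∈ Metric.closedBall (0 : Cn n) R, u x = f x - g x) →
      eLpNorm (fun x => f x - g x) 2 volume ≤ ε →
      eLpNorm u 2 (volume.restrict (Metric.closedBall 0 R)) ≤ ε := by
    intro f g u hu hle
    refine le_of_eq_of_le (eLpNorm_congr_ae ?_) ((eLpNorm_mono_measure _
      (Measure.restrict_le_self (s := Metric.closedBall 0 R))).trans hle)
    filter_upwards [ae_restrict_mem Metric.isClosed_closedBall.measurableSet] with x hx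
    exact hu x hx
  have hmem : ∀ x ∈ Metric.closedBall (0 : Cn n) R, x ∈ B := fun x hx =>
    Metric.closedBall_subset_closedBall (by linarith) hx
  have hnear : ∀ x ∈ Metric.closedBall (0 : Cn n) R, ∀ t, t ∉ B → ρ.rOut ≤ ‖x - t‖ := by
    intro x hx t ht
    simp only [hB, Metric.mem_closedBall, dist_zero_right, not_le] at hx ht
    have := norm_sub_norm_le t x
    rw [norm_sub_rev] at this
    change r ≤ _
    linarith
  refine ⟨mollify ρ (B.indicator h), contDiff_mollify ρ hloc, ?_, fun j => ?_⟩
  · refine hsub (mollify ρ (B.indicator h)) (B.indicator h) _ (fun x hx => ?_)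
      (eLpNorm_mollify_sub_le ρ hf fun k hk => h₀ k (hk.trans_le hr2))
    rw [Set.indicator_of_mem (hmem x hx)]
  · refine hsub (mollify ρ (B.indicator (H j))) (B.indicator (H j)) _ (fun x hx => ?_)
      (eLpNorm_mollify_sub_le ρ (hF j) fun k hk => h₁ j k (hk.trans_le (hr3 j)))
    rw [Set.indicator_of_mem (hmem x hx)]
    congr 1
    rw [partialD_mollify ρ hloc, mollify_apply]
    have hz : ∀ t, t ∉ B → partialD j (mollifier ρ) (x - t) = 0 := by
      intro t ht
      have h1 := hnear x hx t ht
      have h3 : partialD j (mollifier ρ) (x - t)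
          = ((partialD j (ρ.normed volume) (x - t) : ℝ) : ℂ) := by
        have hd : DifferentiableAt ℝ (ρ.normed volume) (x - t) :=
          (ρ.contDiff_normed (n := 1)).differentiable one_ne_zero _
        have := (Complex.ofRealCLM.hasFDerivAt (x := ρ.normed volume (x - t))).comp (x - t)
          hd.hasFDerivAt
        rw [partialD, partialD]
        change fderiv ℝ (Complex.ofRealCLM ∘ ρ.normed volume) (x - t) (coordDir j) = _
        rw [this.fderiv]
        rfl
      -- A nonnegative function is minimal where it vanishes, so its derivative vanishes there too,
      -- even on the sphere bounding the support.
      have h4 : IsLocalMin (ρ.normed volume) (x - t) := by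
        refine Eventually.of_forall fun y => ?_
        rw [normed_eq_zero ρ h1]
        exact ρ.nonneg_normed y
      rw [h3, partialD, h4.fderiv_eq_zero]
      simp
    -- Off `B` the kernel derivative is zero, so the truncation can be dropped and `t ↦ mollifier ρ
    -- (x - t)` used as test function. The sign from differentiating in `t` cancels the sign in the
    -- weak derivative.
    have e1 : ∫ t, B.indicator h t * partialD j (mollifier ρ) (x - t)
        = -∫ t, h t * partialD j (fun t => mollifier ρ (x - t)) t := by
      rw [← integral_neg]
      refine integral_congr_ae (Eventually.of_forall fun t => ?_)
      simp only [partialD_comp_sub ((contDiff_mollifier ρ).differentiable (by simp))]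
      by_cases ht : t ∈ B
      · rw [Set.indicator_of_mem ht]; ring
      · rw [hz t ht]; simp
    rw [e1, hh.integral_eq j (fun t => mollifier ρ (x - t))
      ((contDiff_mollifier ρ).comp (contDiff_const.sub contDiff_id))
      ((hasCompactSupport_mollifier ρ).comp_homeomorph (Homeomorph.subLeft x)), neg_neg]
    refine integral_congr_ae (Eventually.of_forall fun t => ?_)
    by_cases ht : t ∈ B
    · simp only [Set.indicator_of_mem ht]
    · simp only [mollifier_eq_zero ρ (hnear x hx t ht), mul_zero]

/-! ### Real coordinates, translation estimates and local means. -/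

variable {n : ℕ}

theorem orthonormal_coordDir : Orthonormal ℝ (coordDir : Fin n ⊕ Fin n → Cn n) := by
  rw [orthonormal_iff_ite]
  rintro (i | i) (j | j) <;> rcases eq_or_ne i j with rfl | h <;>
    simp [coordDir, PiLp.inner_apply, Complex.inner, *]
  all_goals
    refine Finset.sum_eq_zero fun x _ => ?_
    split_ifs <;> simp_all

/-- The real coordinate directions form an orthonormal basis. -/
def coordBasis : OrthonormalBasis (Fin n ⊕ Fin n) ℝ (Cn n) :=
  OrthonormalBasis.mk orthonormal_coordDir <| by
    intro z _
    have : z = ∑ k : Fin n, ((z k).re • coordDir (Sum.inl k) + (z k).im • coordDir (Sum.inr k)) := by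
      ext i
      simp [coordDir, Pi.single_apply, Finset.sum_add_distrib, Complex.re_add_im]
    rw [this]
    exact Submodule.sum_mem _ fun k _ => Submodule.add_mem _
      (Submodule.smul_mem _ _ (Submodule.subset_span ⟨_, rfl⟩))
      (Submodule.smul_mem _ _ (Submodule.subset_span ⟨_, rfl⟩))

theorem coordBasis_apply (j : Fin n ⊕ Fin n) : coordBasis j = (coordDir j : Cn n) := by
  simp [coordBasis]

theorem norm_coordDir (j : Fin n ⊕ Fin n) : ‖(coordDir j : Cn n)‖ = 1 :=
  orthonormal_coordDir.1 j

theorem laplacian_eq_sum {φ : Cn n → ℝ} (hφ : ContDiff ℝ 2 φ) (z : Cn n) :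
    Δ φ z = ∑ j, partialD j (partialD j φ) z := by
  rw [InnerProductSpace.laplacian_eq_iteratedFDeriv_orthonormalBasis φ coordBasis]
  refine Finset.sum_congr rfl fun j _ => ?_
  have hd : DifferentiableAt ℝ (fderiv ℝ φ) z :=
    ((hφ.fderiv_right (m := 1) (by norm_num)).differentiable one_ne_zero) z
  have := (hd.hasFDerivAt.clm_apply (hasFDerivAt_const (coordDir j) z)).fderiv
  change _ = fderiv ℝ (fun y => fderiv ℝ φ y (coordDir j)) z (coordDir j)
  rw [iteratedFDeriv_two_apply, this]
  simp [coordBasis_apply]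

theorem gradSq_eq_sum (φ : Cn n → ℝ) (z : Cn n) : gradSq φ z = ∑ j, partialD j φ z ^ 2 := by
  simp [gradSq, Fintype.sum_sum_type, Finset.sum_add_distrib]

/-- Cauchy–Schwarz after expanding `k` in the orthonormal coordinate basis. -/
theorem norm_fderiv_sq_le (v : Cn n → ℂ) (x k : Cn n) :
    ‖fderiv ℝ v x k‖ ^ 2 ≤ ‖k‖ ^ 2 * ∑ j, ‖partialD j v x‖ ^ 2 := by
  have h1 : fderiv ℝ v x k = ∑ j, (coordBasis.repr k j) • partialD j v x := by
    conv_lhs => rw [← coordBasis.sum_repr k]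
    simp [partialD, coordBasis_apply]
  have h2 : ‖k‖ ^ 2 = ∑ j, (coordBasis.repr k j) ^ 2 := by
    rw [← coordBasis.repr.norm_map k, EuclideanSpace.norm_sq_eq]
    simp
  calc ‖fderiv ℝ v x k‖ ^ 2 ≤ (∑ j, |coordBasis.repr k j| * ‖partialD j v x‖) ^ 2 := by
        rw [h1]
        gcongr
        refine (norm_sum_le _ _).trans_eq ?_
        simp
    _ ≤ (∑ j, |coordBasis.repr k j| ^ 2) * ∑ j, ‖partialD j v x‖ ^ 2 :=
        Finset.sum_mul_sq_le_sq_mul_sq _ _ _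
    _ = _ := by simp [h2]

theorem enorm_fderiv_sq_le (v : Cn n → ℂ) (x k : Cn n) :
    ‖fderiv ℝ v x k‖ₑ ^ 2 ≤ ‖k‖ₑ ^ 2 * ∑ j, ‖partialD j v x‖ₑ ^ 2 := by
  have := ENNReal.ofReal_le_ofReal (norm_fderiv_sq_le v x k)
  rw [ENNReal.ofReal_mul (by positivity), ENNReal.ofReal_sum_of_nonneg (by intros; positivity)] at this
  simpa only [ENNReal.ofReal_pow (norm_nonneg _), ofReal_norm] using this

theorem lintegral_closedBall_translate_le (G : Cn n → ℝ≥0∞) {r s : ℝ} {k : Cn n}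
    (hk : r + ‖k‖ ≤ s) :
    ∫⁻ x in Metric.closedBall 0 r, G (x + k) ≤ ∫⁻ x in Metric.closedBall 0 s, G x := by
  rw [← lintegral_indicator Metric.isClosed_closedBall.measurableSet,
    ← lintegral_indicator Metric.isClosed_closedBall.measurableSet,
    ← lintegral_add_right_eq_self ((Metric.closedBall 0 s).indicator G) k]
  refine lintegral_mono fun x => Set.indicator_apply_le' (fun hx => ?_) fun _ => zero_le
  rw [Set.indicator_of_mem]
  rw [Metric.mem_closedBall, dist_zero_right] at hx ⊢
  linarith [norm_add_le x k]

theorem eLpNorm_translate_le {u : Cn n → ℂ} {r s : ℝ} {k : Cn n}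
    (hk : r + ‖k‖ ≤ s) :
    eLpNorm (fun x => u (x + k)) 2 (volume.restrict (Metric.closedBall 0 r)) ≤
      eLpNorm u 2 (volume.restrict (Metric.closedBall 0 s)) := by
  refine eLpNorm_two_le_of_lintegral_sq_le ?_
  rw [eLpNorm_two_sq]
  exact lintegral_closedBall_translate_le (fun x => ‖u x‖ₑ ^ 2) hk

theorem sum_sq_le_sq_sum_ennreal {ι : Type*} (s : Finset ι) (f : ι → ℝ≥0∞) :
    ∑ i ∈ s, f i ^ 2 ≤ (∑ i ∈ s, f i) ^ 2 := by
  rw [sq, Finset.sum_mul]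
  refine Finset.sum_le_sum fun i hi => ?_
  rw [sq]
  gcongr
  exact Finset.single_le_sum_of_canonicallyOrdered hi

/-- The difference is the mean over `t ∈ (0, 1]` of the derivative in direction `k` at `x + t k`.
Jensen and Tonelli leave translates by `t k`, which keep the ball of radius `r` inside the one of
radius `s`. -/
theorem eLpNorm_translate_sub_le_of_contDiff {v : Cn n → ℂ} (hv : ContDiff ℝ 1 v) {r s : ℝ}
    {k : Cn n} (hk : r + ‖k‖ ≤ s) :
    eLpNorm (fun x => v (x + k) - v x) 2 (volume.restrict (Metric.closedBall 0 r)) ≤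
      ‖k‖ₑ * ∑ j, eLpNorm (partialD j v) 2 (volume.restrict (Metric.closedBall 0 s)) := by
  set ν : Measure ℝ := volume.restrict (Set.Ioc 0 1) with hν
  have : IsProbabilityMeasure ν := ⟨by simp [hν]⟩
  have hfc : Continuous (fderiv ℝ v) := hv.continuous_fderiv one_ne_zero
  have hpc : ∀ j, Continuous (partialD j v) := fun j => continuous_partialD hv j
  set G : Cn n → ℝ≥0∞ := fun x => ∑ j, ‖partialD j v x‖ₑ ^ 2 with hG
  have hrep : ∀ x, v (x + k) - v x = ∫ t, fderiv ℝ v (x + t • k) k ∂ν := by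
    intro x
    have hd : ∀ t ∈ Set.uIcc (0 : ℝ) 1,
        HasDerivAt (fun t : ℝ => v (x + t • k)) (fderiv ℝ v (x + t • k) k) t := by
      intro t _
      have h1 : HasDerivAt (fun t : ℝ => x + t • k) k t := by
        simpa using ((hasDerivAt_id t).smul_const k).const_add x
      exact ((hv.differentiable one_ne_zero _).hasFDerivAt).comp_hasDerivAt t h1
    have := intervalIntegral.integral_eq_sub_of_hasDerivAt hd
      (Continuous.intervalIntegrable (by fun_prop) _ _)
    rw [intervalIntegral.integral_of_le zero_le_one] at this
    rw [hν, this]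
    simp
  refine eLpNorm_two_le_of_lintegral_sq_le ?_
  have hm : Measurable fun p : Cn n × ℝ => ‖fderiv ℝ v (p.1 + p.2 • k) k‖ₑ ^ 2 := by
    have : Continuous fun p : Cn n × ℝ => fderiv ℝ v (p.1 + p.2 • k) k := by fun_prop
    exact this.measurable.enorm.pow_const 2
  calc ∫⁻ x in Metric.closedBall 0 r, ‖v (x + k) - v x‖ₑ ^ 2
      ≤ ∫⁻ x in Metric.closedBall 0 r, ∫⁻ t, ‖fderiv ℝ v (x + t • k) k‖ₑ ^ 2 ∂ν := by
        refine lintegral_mono fun x => ?_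
        rw [hrep]
        refine enorm_integral_sq_le ?_
        have : Continuous fun t : ℝ => fderiv ℝ v (x + t • k) k := by fun_prop
        exact this.aestronglyMeasurable
    _ = ∫⁻ t, ∫⁻ x in Metric.closedBall 0 r, ‖fderiv ℝ v (x + t • k) k‖ₑ ^ 2 ∂volume ∂ν :=
        lintegral_lintegral_swap hm.aemeasurable
    _ ≤ ∫⁻ t, ‖k‖ₑ ^ 2 * ∫⁻ x in Metric.closedBall 0 s, G x ∂volume ∂ν := by
        refine lintegral_mono_ae ?_
        filter_upwards [ae_restrict_mem measurableSet_Ioc] with t ht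
        rw [← lintegral_const_mul' _ _ (by simp)]
        refine le_trans (lintegral_mono fun x => enorm_fderiv_sq_le v _ k)
          (lintegral_closedBall_translate_le (fun x => ‖k‖ₑ ^ 2 * G x) (le_trans ?_ hk))
        rw [norm_smul, Real.norm_of_nonneg ht.1.le]
        nlinarith [norm_nonneg k, ht.2]
    _ = ‖k‖ₑ ^ 2 * ∫⁻ x in Metric.closedBall 0 s, G x := by simp
    _ = ‖k‖ₑ ^ 2 * ∑ j, eLpNorm (partialD j v) 2 (volume.restrict (Metric.closedBall 0 s)) ^ 2 := by
        rw [hG, lintegral_finsetSum _ fun j _ => ((hpc j).measurable.enorm.pow_const 2)]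
        simp only [eLpNorm_two_sq]
    _ ≤ _ := by
        rw [mul_pow]
        gcongr
        exact sum_sq_le_sq_sum_ennreal _ _

/-- Follows from the smooth case by approximation on the larger ball, which also contains the
translated points; the error then tends to zero. -/
theorem HasWeakPartials.eLpNorm_translate_sub_le {h : Cn n → ℂ} {H : Fin n ⊕ Fin n → Cn n → ℂ}
    (hh : HasWeakPartials h H) {r s : ℝ} {k : Cn n} (hk : r + ‖k‖ ≤ s) :
    eLpNorm (fun x => h (x + k) - h x) 2 (volume.restrict (Metric.closedBall 0 r)) ≤
      ‖k‖ₑ * ∑ j, eLpNorm (H j) 2 (volume.restrict (Metric.closedBall 0 s)) := by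
  have hrs : r ≤ s := by linarith [norm_nonneg k]
  have key : ∀ ε : ℝ≥0∞, 0 < ε →
      eLpNorm (fun x => h (x + k) - h x) 2 (volume.restrict (Metric.closedBall 0 r)) ≤
      ‖k‖ₑ * ∑ j, (eLpNorm (H j) 2 (volume.restrict (Metric.closedBall 0 s)) + ε) + ε + ε := by
    intro ε hε
    obtain ⟨v, hv, hv0, hvj⟩ := hh.exists_smooth_approx s hε
    have hvm : ∀ R : ℝ, AEStronglyMeasurable v (volume.restrict (Metric.closedBall 0 R)) :=
      fun R => hv.continuous.aestronglyMeasurable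
    -- Measurability of `h` is known only almost everywhere on balls; it passes to the translate
    -- because null sets pull back to null sets.
    have hmap : Measure.QuasiMeasurePreserving (fun x : Cn n => x + k)
        (volume.restrict (Metric.closedBall 0 r)) (volume.restrict (Metric.closedBall 0 s)) := by
      refine ⟨measurable_add_const k, Measure.AbsolutelyContinuous.mk fun A hA hA0 => ?_⟩
      rw [Measure.map_apply (measurable_add_const k) hA]
      have := lintegral_closedBall_translate_le (A.indicator 1) hk
      rw [lintegral_indicator_one hA, hA0] at this
      rw [← lintegral_indicator_one (measurable_add_const k hA)]
      exact le_antisymm this zero_le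
    have m1 : AEStronglyMeasurable (fun x => v x - h x) (volume.restrict (Metric.closedBall 0 s)) :=
      (hvm s).sub (hh.memLp s).1
    have m1' : AEStronglyMeasurable (fun x => v x - h x)
        (volume.restrict (Metric.closedBall 0 r)) :=
      (hvm r).sub (hh.memLp r).1
    have m2 : AEStronglyMeasurable (fun x => v (x + k) - h (x + k))
        (volume.restrict (Metric.closedBall 0 r)) := m1.comp_quasiMeasurePreserving hmap
    have m3 : AEStronglyMeasurable (fun x => v (x + k) - v x)
        (volume.restrict (Metric.closedBall 0 r)) := by
      have : Continuous fun x => v (x + k) - v x := by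
        have := hv.continuous
        fun_prop
      exact this.aestronglyMeasurable
    have e1 : (fun x => h (x + k) - h x) =
        ((fun x => v (x + k) - v x) + fun x => v x - h x) - fun x => v (x + k) - h (x + k) := by
      ext x
      simp only [Pi.sub_apply, Pi.add_apply]
      ring
    rw [e1]
    refine (eLpNorm_sub_le (m3.add m1') m2 (by norm_num)).trans ?_
    refine add_le_add ((eLpNorm_add_le m3 m1' (by norm_num)).trans (add_le_add ?_ ?_)) ?_
    · refine (eLpNorm_translate_sub_le_of_contDiff (hv.of_le (by norm_cast)) hk).trans ?_
      gcongr with j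
      have e2 : partialD j v = (H j) + fun x => partialD j v x - H j x := by
        ext x; simp
      have hpm : AEStronglyMeasurable (partialD j v) (volume.restrict (Metric.closedBall 0 s)) :=
        (continuous_partialD (hv.of_le (by norm_cast)) j).aestronglyMeasurable
      rw [e2]
      refine (eLpNorm_add_le (hh.memLp_partial j s).1 (hpm.sub (hh.memLp_partial j s).1)
        (by norm_num)).trans ?_
      gcongr
      exact hvj j
    · exact (eLpNorm_mono_measure _ (Measure.restrict_mono
        (Metric.closedBall_subset_closedBall hrs) le_rfl)).trans hv0
    · exact (eLpNorm_translate_le (u := fun x => v x - h x) hk).trans hv0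
  have hlim : Tendsto (fun ε : ℝ≥0∞ =>
      ‖k‖ₑ * ∑ j, (eLpNorm (H j) 2 (volume.restrict (Metric.closedBall 0 s)) + ε) + ε + ε)
      (𝓝[>] 0) (𝓝 (‖k‖ₑ * ∑ j, (eLpNorm (H j) 2 (volume.restrict (Metric.closedBall 0 s)) + 0)
        + 0 + 0)) := by
    refine tendsto_nhdsWithin_of_tendsto_nhds ?_
    refine Tendsto.add (Tendsto.add (ENNReal.Tendsto.const_mul ?_ (Or.inr (by simp))) tendsto_id)
      tendsto_id
    exact tendsto_finsetSum _ fun j _ => tendsto_const_nhds.add tendsto_id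
  have := ge_of_tendsto hlim (eventually_mem_nhdsWithin.mono fun ε hε => key ε hε)
  simpa using this

/-- The ball of radius `δ` about `s x` lies in the one of radius `2δ` about `x`. Enlarging it
removes the dependence on `s`, costs the volume ratio `2 ^ d`, and leaves a mean over translations
by `‖k‖ < 2δ ≤ 1`, to which the translation bound applies. -/
theorem HasWeakPartials.eLpNorm_sub_average_le {h : Cn n → ℂ} {H : Fin n ⊕ Fin n → Cn n → ℂ}
    (hh : HasWeakPartials h H) (hm : StronglyMeasurable h) {r δ : ℝ} (hδ : 0 < δ) (hδ1 : 2 * δ ≤ 1)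
    {s : Cn n → Cn n} (hs : ∀ x ∈ Metric.closedBall 0 r, dist (s x) x < δ) :
    eLpNorm (fun x => h x - ⨍ y in Metric.ball (s x) δ, h y) 2
        (volume.restrict (Metric.closedBall 0 r)) ≤
      2 ^ Module.finrank ℝ (Cn n) * ENNReal.ofReal (2 * δ) *
        ∑ j, eLpNorm (H j) 2 (volume.restrict (Metric.closedBall 0 (r + 1))) := by
  set S := ∑ j, eLpNorm (H j) 2 (volume.restrict (Metric.closedBall 0 (r + 1))) with hS
  set d := Module.finrank ℝ (Cn n)
  set V : ℝ≥0∞ := volume (Metric.ball (0 : Cn n) δ) with hV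
  have hV0 : V ≠ 0 := (Metric.measure_ball_pos volume _ hδ).ne'
  have hVt : V ≠ ⊤ := measure_ball_lt_top.ne
  have hVp : ∀ p : Cn n, volume (Metric.ball p δ) = V := fun p => Measure.addHaar_ball_center _ _ _
  have hV2 : volume (Metric.ball (0 : Cn n) (2 * δ)) = 2 ^ d * V := by
    rw [Measure.addHaar_ball_mul_of_pos _ _ two_pos, ENNReal.ofReal_pow zero_le_two]
    simp [hV, d]
  have hpt : ∀ x ∈ Metric.closedBall (0 : Cn n) r, ‖h x - ⨍ y in Metric.ball (s x) δ, h y‖ₑ ^ 2 ≤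
      V⁻¹ * ∫⁻ k in Metric.ball 0 (2 * δ), ‖h (x + k) - h x‖ₑ ^ 2 := by
    intro x hx
    set ν : Measure (Cn n) := V⁻¹ • volume.restrict (Metric.ball (s x) δ) with hν
    have : IsProbabilityMeasure ν := ⟨by
      rw [hν, Measure.smul_apply, Measure.restrict_apply_univ, hVp, smul_eq_mul,
        ENNReal.inv_mul_cancel hV0 hVt]⟩
    have hint : Integrable h ν := by
      refine Integrable.smul_measure ?_ (ENNReal.inv_ne_top.2 hV0)
      have h1 : MemLp h 1 (volume.restrict (Metric.ball (s x) δ)) := by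
        have hle : volume.restrict (Metric.ball (s x) δ) ≤
            volume.restrict (Metric.closedBall 0 (‖s x‖ + δ)) := by
          refine Measure.restrict_mono (fun y hy => ?_) le_rfl
          rw [Metric.mem_ball, dist_eq_norm] at hy
          rw [Metric.mem_closedBall, dist_zero_right]
          linarith [norm_sub_norm_le y (s x)]
        have : IsFiniteMeasure (volume.restrict (Metric.ball (s x) δ)) :=
          ⟨by rw [Measure.restrict_apply_univ]; exact measure_ball_lt_top⟩
        exact ((hh.memLp _).mono_measure hle).mono_exponent (by norm_num)
      exact memLp_one_iff_integrable.1 h1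
    have havg : ⨍ y in Metric.ball (s x) δ, h y = ∫ y, h y ∂ν := by
      rw [average, Measure.restrict_apply_univ, hVp]
    have hrep : h x - ⨍ y in Metric.ball (s x) δ, h y = ∫ y, (h x - h y) ∂ν := by
      rw [integral_sub (integrable_const _) hint, havg]
      simp
    calc ‖h x - ⨍ y in Metric.ball (s x) δ, h y‖ₑ ^ 2
        ≤ ∫⁻ y, ‖h x - h y‖ₑ ^ 2 ∂ν := by
          rw [hrep]
          exact enorm_integral_sq_le ((integrable_const _).sub hint).aestronglyMeasurable
      _ = V⁻¹ * ∫⁻ y in Metric.ball (s x) δ, ‖h x - h y‖ₑ ^ 2 := by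
          rw [hν, lintegral_smul_measure, smul_eq_mul]
      _ ≤ V⁻¹ * ∫⁻ y in Metric.ball x (2 * δ), ‖h x - h y‖ₑ ^ 2 := by
          gcongr
          refine Metric.ball_subset_ball' ?_
          linarith [hs x hx]
      _ = _ := by
          congr 1
          rw [← lintegral_indicator Metric.isOpen_ball.measurableSet,
            ← lintegral_indicator Metric.isOpen_ball.measurableSet,
            ← lintegral_add_left_eq_self _ x]
          refine lintegral_congr fun k => ?_
          simp only [Set.indicator, Metric.mem_ball, dist_self_add_left, dist_zero_right]
          rw [← enorm_neg, neg_sub]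
  refine eLpNorm_two_le_of_lintegral_sq_le ?_
  have hm2 : Measurable fun p : Cn n × Cn n => ‖h (p.1 + p.2) - h p.1‖ₑ ^ 2 := by
    have := hm.measurable
    fun_prop
  calc ∫⁻ x in Metric.closedBall 0 r, ‖h x - ⨍ y in Metric.ball (s x) δ, h y‖ₑ ^ 2
      ≤ ∫⁻ x in Metric.closedBall 0 r,
          V⁻¹ * ∫⁻ k in Metric.ball 0 (2 * δ), ‖h (x + k) - h x‖ₑ ^ 2 :=
        setLIntegral_mono' Metric.isClosed_closedBall.measurableSet hpt
    _ = V⁻¹ * ∫⁻ k in Metric.ball 0 (2 * δ), ∫⁻ x in Metric.closedBall 0 r,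
          ‖h (x + k) - h x‖ₑ ^ 2 := by
        rw [lintegral_const_mul' _ _ (ENNReal.inv_ne_top.2 hV0),
          lintegral_lintegral_swap hm2.aemeasurable]
    _ ≤ V⁻¹ * ∫⁻ k in Metric.ball (0 : Cn n) (2 * δ), (ENNReal.ofReal (2 * δ) * S) ^ 2 := by
        gcongr V⁻¹ * ?_
        refine setLIntegral_mono' Metric.isOpen_ball.measurableSet fun k hk => ?_
        rw [Metric.mem_ball, dist_zero_right] at hk
        rw [← eLpNorm_two_sq]
        gcongr
        refine (hh.eLpNorm_translate_sub_le (s := r + 1) (by linarith)).trans ?_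
        gcongr
        rw [← ofReal_norm]
        exact ENNReal.ofReal_le_ofReal hk.le
    _ = 2 ^ d * (ENNReal.ofReal (2 * δ) * S) ^ 2 := by
        rw [lintegral_const, Measure.restrict_apply_univ, hV2]
        calc _ = (V⁻¹ * V) * (2 ^ d * (ENNReal.ofReal (2 * δ) * S) ^ 2) := by ring
          _ = _ := by rw [ENNReal.inv_mul_cancel hV0 hVt, one_mul]
    -- Replacing `2 ^ d` by its square is wasteful but avoids a square root.
    _ ≤ _ := by
        rw [mul_assoc, mul_pow _ (ENNReal.ofReal (2 * δ) * S)]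
        gcongr ?_ * _
        exact le_self_pow₀ (one_le_pow₀ (by norm_num : (1 : ℝ≥0∞) ≤ 2)) two_ne_zero

/-- Bounded sets are uniformly approximated by finitely many of their points, measurably. -/
theorem exists_simpleFunc_dist_lt (r : ℝ) {δ : ℝ} (hδ : 0 < δ) :
    ∃ s : SimpleFunc (Cn n) (Cn n), ∀ x ∈ Metric.closedBall (0 : Cn n) r, dist (s x) x < δ := by
  set e := TopologicalSpace.denseSeq (Cn n)
  have hcov : Metric.closedBall (0 : Cn n) r ⊆ ⋃ i, Metric.ball (e i) δ := by
    intro x _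
    obtain ⟨i, hi⟩ := (TopologicalSpace.denseRange_denseSeq (Cn n)).exists_dist_lt x hδ
    exact Set.mem_iUnion.2 ⟨i, hi⟩
  obtain ⟨t, ht⟩ := (isCompact_closedBall (0 : Cn n) r).elim_finite_subcover _
    (fun i => Metric.isOpen_ball) hcov
  -- The nearest point is sought among all points of index up to the largest index in the finite
  -- subcover.
  refine ⟨SimpleFunc.nearestPt e (t.sup id), fun x hx => ?_⟩
  obtain ⟨i, hi, hxi⟩ := Set.mem_iUnion₂.1 (ht hx)
  have h1 := SimpleFunc.edist_nearestPt_le e x (Finset.le_sup (f := id) hi)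
  rw [edist_dist, edist_dist, ENNReal.ofReal_le_ofReal_iff dist_nonneg] at h1
  refine h1.trans_lt ?_
  rw [dist_comm]
  exact hxi

/-! ### The basic estimate for `C¹` functions. -/

variable {n : ℕ}

theorem partialD_eq_zero_of_notMem_tsupport {F : Type*} [NormedAddCommGroup F] [NormedSpace ℝ F]
    {u : Cn n → F} {x : Cn n} (hx : x ∉ tsupport u) (j : Fin n ⊕ Fin n) : partialD j u x = 0 := by
  have : fderiv ℝ u x = 0 := by
    by_contra hne
    exact hx (support_fderiv_subset ℝ hne)
  rw [partialD, this]; rfl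

theorem contDiff_partialD {F : Type*} [NormedAddCommGroup F] [NormedSpace ℝ F] {u : Cn n → F}
    {m k : ℕ∞} (hu : ContDiff ℝ k u) (hmk : m + 1 ≤ k) (j : Fin n ⊕ Fin n) :
    ContDiff ℝ m (partialD j u) :=
  (hu.fderiv_right (by exact_mod_cast hmk)).clm_apply contDiff_const

/-- The function `η² |∇φ|² + (1 + ε) η △φ`. -/
def potential (φ : Cn n → ℝ) (η ε : ℝ) (z : Cn n) : ℝ :=
  η ^ 2 * gradSq φ z + (1 + ε) * η * Δ φ z

theorem potential_eq_sum {φ : Cn n → ℝ} (hφ : ContDiff ℝ 2 φ) (η ε : ℝ) (z : Cn n) :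
    potential φ η ε z = ∑ j, (η ^ 2 * partialD j φ z ^ 2 +
      (1 + ε) * η * partialD j (partialD j φ) z) := by
  rw [potential, gradSq_eq_sum, laplacian_eq_sum hφ, Finset.sum_add_distrib, Finset.mul_sum,
    Finset.mul_sum]

theorem continuous_potential {φ : Cn n → ℝ} (hφ : ContDiff ℝ 2 φ) (η ε : ℝ) :
    Continuous (potential φ η ε) := by
  have h1 : ∀ j, ContDiff ℝ 1 (partialD j φ) := fun j =>
    contDiff_partialD (k := 2) (m := 1) hφ (by norm_num) j
  have h2 : ∀ j, Continuous (partialD j φ) := fun j => (h1 j).continuous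
  have h3 : ∀ j, Continuous (partialD j (partialD j φ)) := fun j => continuous_partialD (h1 j) j
  rw [funext (potential_eq_sum hφ η ε)]
  fun_prop

/-- The basic estimate: a twisted Dirichlet form controls the potential. -/
theorem integral_potential_mul_le {φ : Cn n → ℝ} (hφ : ContDiff ℝ 2 φ) (η : ℝ) {ε : ℝ} (hε : 0 < ε)
    {u : Cn n → ℂ} (hu : ContDiff ℝ 1 u) (hc : HasCompactSupport u) :
    ∫ z, potential φ η ε z * ‖u z‖ ^ 2 ≤
      (1 + ε) ^ 2 / ε * ∑ j, ∫ z, ‖partialD j u z - (η / 2 * partialD j φ z) • u z‖ ^ 2 := by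
  have ha : ∀ j, ContDiff ℝ 1 (partialD j φ) := fun j =>
    contDiff_partialD (k := 2) (m := 1) hφ (by norm_num) j
  have hac : ∀ j, Continuous (partialD j φ) := fun j => (ha j).continuous
  have haa : ∀ j, Continuous (partialD j (partialD j φ)) := fun j => continuous_partialD (ha j) j
  have huc := hu.continuous
  have hpu : ∀ j, Continuous (partialD j u) := fun j => continuous_partialD hu j
  have hz : ∀ x, x ∉ tsupport u → u x = 0 := fun x hx => image_eq_zero_of_notMem_tsupport hx
  have hzp : ∀ j x, x ∉ tsupport u → partialD j u x = 0 := fun j x hx =>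
    partialD_eq_zero_of_notMem_tsupport hx j
  have hint : ∀ f : Cn n → ℝ, Continuous f → (∀ x, x ∉ tsupport u → f x = 0) → Integrable f :=
    fun f hf h0 => hf.integrable_of_hasCompactSupport (HasCompactSupport.intro hc h0)
  set D : Fin n ⊕ Fin n → Cn n → ℂ :=
    fun j z => partialD j u z - (η / 2 * partialD j φ z) • u z with hD
  have hDc : ∀ j, Continuous (D j) := by
    intro j
    have := hac j
    have := hpu j
    simp only [hD]
    fun_prop
  have hDz : ∀ j x, x ∉ tsupport u → D j x = 0 := by
    intro j x hx
    simp [hD, hz x hx, hzp j x hx]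
  -- This is `η ∂_j (∂_jφ |u|²)` with `∂_j u` expressed through `D j`, so its integral vanishes.
  set w : Fin n ⊕ Fin n → Cn n → ℝ := fun j z =>
    η * partialD j (partialD j φ) z * ‖u z‖ ^ 2 + (2 * (η * partialD j φ z) * inner ℝ (u z) (D j z)
      + (η * partialD j φ z) ^ 2 * ‖u z‖ ^ 2) with hw
  have hwint : ∀ j, Integrable (w j) := by
    intro j
    have := hac j
    have := haa j
    have := hDc j
    refine hint _ (by simp only [hw]; fun_prop) fun x hx => ?_
    simp [hw, hz x hx]
  have hfd : ∀ j x, fderiv ℝ (fun z => ‖u z‖ ^ 2) x (coordDir j) =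
      2 * inner ℝ (u x) (D j x) + η * partialD j φ x * ‖u x‖ ^ 2 := by
    intro j x
    have := ((hu.differentiable one_ne_zero x).hasFDerivAt.norm_sq).fderiv
    rw [this]
    have h2 : partialD j u x = D j x + (η / 2 * partialD j φ x) • u x := by simp [hD]
    have h3 : inner ℝ (u x) (fderiv ℝ u x (coordDir j)) =
        inner ℝ (u x) (D j x) + η / 2 * partialD j φ x * ‖u x‖ ^ 2 := by
      change inner ℝ (u x) (partialD j u x) = _
      rw [h2, inner_add_right, inner_smul_right, real_inner_self_eq_norm_sq]
    simp only [smul_apply, ContinuousLinearMap.comp_apply,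
      innerSL_apply_apply, h3, nsmul_eq_mul]
    push_cast
    ring
  have hw0 : ∀ j, ∫ z, w j z = 0 := by
    intro j
    have := hac j
    have := haa j
    have := hDc j
    have hn : ContDiff ℝ 1 fun z => ‖u z‖ ^ 2 := hu.norm_sq ℝ
    have hcf : Continuous fun x => fderiv ℝ (fun z => ‖u z‖ ^ 2) x (coordDir j) :=
      continuous_partialD hn j
    have i1 : Integrable fun z => partialD j φ z * fderiv ℝ (fun z => ‖u z‖ ^ 2) z (coordDir j) :=
      hint _ (by fun_prop) fun x hx => by rw [hfd]; simp [hz x hx]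
    have i2 : Integrable fun z => fderiv ℝ (partialD j φ) z (coordDir j) * ‖u z‖ ^ 2 := by
      refine hint _ ?_ fun x hx => by simp [hz x hx]
      have : Continuous fun z => fderiv ℝ (partialD j φ) z (coordDir j) := haa j
      fun_prop
    have ibp := integral_mul_fderiv_eq_neg_fderiv_mul_of_integrable
      (f := partialD j φ) (g := fun z => ‖u z‖ ^ 2) (v := coordDir j) (μ := volume)
      i2 i1 (hint _ (by fun_prop) fun x hx => by simp [hz x hx])
      (fun x _ => (ha j).differentiable one_ne_zero x)
      (fun x _ => hn.differentiable one_ne_zero x)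
    have e : w j = fun z => η * (partialD j φ z * fderiv ℝ (fun z => ‖u z‖ ^ 2) z (coordDir j)
        + fderiv ℝ (partialD j φ) z (coordDir j) * ‖u z‖ ^ 2) := by
      ext z
      rw [hfd]
      change η * (fderiv ℝ (partialD j φ) z (coordDir j)) * _ + _ = _
      ring
    rw [e, integral_const_mul, integral_add i1 i2, ibp]
    simp
  have hDi : ∀ j, Integrable fun z => ‖D j z‖ ^ 2 := by
    intro j
    have := hDc j
    exact hint _ (by fun_prop) fun x hx => by simp [hDz j x hx]
  have hsum : ∀ j, Integrable fun z => (1 + ε) * w j z + (1 + ε) ^ 2 / ε * ‖D j z‖ ^ 2 :=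
    fun j => ((hwint j).const_mul _).add ((hDi j).const_mul _)
  calc ∫ z, potential φ η ε z * ‖u z‖ ^ 2
      ≤ ∫ z, ∑ j, ((1 + ε) * w j z + (1 + ε) ^ 2 / ε * ‖D j z‖ ^ 2) := by
        have := continuous_potential hφ η ε
        refine integral_mono (hint _ (by fun_prop) fun x hx => by simp [hz x hx])
          (integrable_finsetSum _ fun j _ => hsum j) fun z => ?_
        simp only
        rw [potential_eq_sum hφ, Finset.sum_mul]
        refine Finset.sum_le_sum fun j _ => ?_
        have hcs := abs_real_inner_le_norm (u z) (D j z)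
        set X := η * partialD j φ z with hX
        set I := inner ℝ (u z) (D j z) with hI
        have e1 : w j z = η * partialD j (partialD j φ) z * ‖u z‖ ^ 2 + (2 * X * I
          + X ^ 2 * ‖u z‖ ^ 2) := rfl
        have h1 : |X * I| ≤ |X| * (‖u z‖ * ‖D j z‖) := by
          rw [abs_mul]; gcongr
        have h2 : 0 ≤ (ε * (|X| * ‖u z‖) - (1 + ε) * ‖D j z‖) ^ 2 / ε := by positivity
        -- Completing the square: `1 + ε` copies of `w` exceed the required terms by `ε X² ‖u‖²` and
        -- the cross term, and `(1 + ε)² / ε` is the coefficient of `‖D‖²` that makes the total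
        -- nonnegative.
        have h3 : (ε * (|X| * ‖u z‖) - (1 + ε) * ‖D j z‖) ^ 2 / ε = ε * (X ^ 2 * ‖u z‖ ^ 2)
            - 2 * (1 + ε) * (|X| * (‖u z‖ * ‖D j z‖)) + (1 + ε) ^ 2 / ε * ‖D j z‖ ^ 2 := by
          rw [← sq_abs X]
          field_simp
          ring
        have h4 := mul_le_mul_of_nonneg_left ((neg_le_abs _).trans h1)
          (by positivity : 0 ≤ 2 * (1 + ε))
        have h5 : η ^ 2 * partialD j φ z ^ 2 = X ^ 2 := by rw [hX]; ring
        rw [e1, h5]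
        linarith
    _ = ∑ j, ((1 + ε) * ∫ z, w j z) + ∑ j, ((1 + ε) ^ 2 / ε * ∫ z, ‖D j z‖ ^ 2) := by
        rw [integral_finsetSum _ fun j _ => hsum j, ← Finset.sum_add_distrib]
        refine Finset.sum_congr rfl fun j _ => ?_
        rw [integral_add ((hwint j).const_mul _) ((hDi j).const_mul _), integral_const_mul,
          integral_const_mul]
    _ = _ := by
        simp only [hw0, mul_zero, Finset.sum_const_zero, zero_add]
        rw [Finset.mul_sum]

theorem lintegral_weight {φ : Cn n → ℝ} (hφ : Continuous φ) (f : Cn n → ℝ≥0∞) :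
    ∫⁻ z, f z ∂(weight φ) = ∫⁻ z, ENNReal.ofReal (Real.exp (-φ z)) * f z := by
  rw [weight, lintegral_withDensity_eq_lintegral_mul_non_measurable _ (by fun_prop) (by simp)]
  rfl

theorem eLpNorm_weight_sq {φ : Cn n → ℝ} (hφ : Continuous φ) {F : Cn n → ℂ} (hF : Continuous F)
    (hc : HasCompactSupport F) :
    eLpNorm F 2 (weight φ) ^ 2 = ENNReal.ofReal (∫ z, Real.exp (-φ z) * ‖F z‖ ^ 2) := by
  rw [eLpNorm_two_sq, lintegral_weight hφ, ofReal_integral_eq_lintegral_ofReal]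
  · refine lintegral_congr fun z => ?_
    rw [ENNReal.ofReal_mul (Real.exp_pos _).le, ENNReal.ofReal_pow (norm_nonneg _), ofReal_norm]
  · refine Continuous.integrable_of_hasCompactSupport (by fun_prop) (HasCompactSupport.intro hc ?_)
    intro x hx
    simp [image_eq_zero_of_notMem_tsupport hx]
  · exact Eventually.of_forall fun z => by positivity

/-- The factor `e^{-φ/2}` turns unweighted norms into weighted ones. Its derivative contributes
`-1/2` to the coefficient of `∂_jφ`, which changes `η / 2` into `(1 + η) / 2`. -/
theorem partialD_conj_weight {φ : Cn n → ℝ} (hφ : ContDiff ℝ 2 φ) (η : ℝ) {χ : Cn n → ℝ}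
    (hχ : ContDiff ℝ 1 χ) {v : Cn n → ℂ} (hv : ContDiff ℝ 1 v) (j : Fin n ⊕ Fin n) (z : Cn n) :
    partialD j (fun z => (Real.exp (-φ z / 2) * χ z) • v z) z
        - (η / 2 * partialD j φ z) • ((Real.exp (-φ z / 2) * χ z) • v z) =
      Real.exp (-φ z / 2) • (χ z • partialD j v z
        + (partialD j χ z - (1 + η) / 2 * partialD j φ z * χ z) • v z) := by
  have h1 : HasFDerivAt φ (fderiv ℝ φ z) z := (hφ.differentiable two_ne_zero z).hasFDerivAt
  have h2 : HasFDerivAt χ (fderiv ℝ χ z) z := (hχ.differentiable one_ne_zero z).hasFDerivAt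
  have h3 : HasFDerivAt v (fderiv ℝ v z) z := (hv.differentiable one_ne_zero z).hasFDerivAt
  have h4 : HasFDerivAt (fun z => -φ z / 2) ((-(1 / 2) : ℝ) • fderiv ℝ φ z) z := by
    refine (h1.const_smul (-(1 / 2) : ℝ)).congr_of_eventuallyEq (Eventually.of_forall fun z => ?_)
    simp only [Pi.smul_apply, smul_eq_mul]
    ring
  have h5 := ((h4.exp.mul h2).smul h3).fderiv
  have h6 : partialD j (fun z => (Real.exp (-φ z / 2) * χ z) • v z) z =
      fderiv ℝ (fun z => (Real.exp (-φ z / 2) * χ z) • v z) z (coordDir j) := rfl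
  have h7 : fderiv ℝ (fun z => (Real.exp (-φ z / 2) * χ z) • v z) z = _ := h5
  rw [h6, h7]
  simp only [partialD, add_apply, smul_apply,
    ContinuousLinearMap.smulRight_apply, Pi.mul_apply, Complex.real_smul, smul_eq_mul]
  push_cast
  ring

/-- The basic estimate for smooth functions in weighted form, localized by a cutoff function. -/
theorem eLpNorm_weight_le_of_contDiff {φ : Cn n → ℝ} (hφ : ContDiff ℝ 2 φ) (η : ℝ) {ε K : ℝ}
    (hε : 0 < ε) (hK1 : 1 ≤ K) (hK : ∀ z, 0 ≤ potential φ η ε z + K) {χ : Cn n → ℝ}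
    (hχ : ContDiff ℝ 1 χ) (hχc : HasCompactSupport χ) {v : Cn n → ℂ} (hv : ContDiff ℝ 1 v) :
    eLpNorm (fun z => (√(potential φ η ε z + K) * χ z) • v z) 2 (weight φ) ≤
      ENNReal.ofReal ((1 + ε) ^ 2 / ε) * ∑ j, eLpNorm (fun z => χ z • partialD j v z
        + (partialD j χ z - (1 + η) / 2 * partialD j φ z * χ z) • v z) 2 (weight φ)
      + ENNReal.ofReal K * eLpNorm (fun z => χ z • v z) 2 (weight φ) := by
  have hφc := hφ.continuous
  have hvc := hv.continuous
  have hχcont := hχ.continuous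
  have hVc := continuous_potential hφ η ε
  set C := (1 + ε) ^ 2 / ε with hC
  have hC1 : 1 ≤ C := by
    rw [hC, le_div_iff₀ hε]
    nlinarith
  set B : Fin n ⊕ Fin n → Cn n → ℂ := fun j z => χ z • partialD j v z
        + (partialD j χ z - (1 + η) / 2 * partialD j φ z * χ z) • v z with hB
  have hχz : ∀ x, x ∉ tsupport χ → χ x = 0 := fun x hx => image_eq_zero_of_notMem_tsupport hx
  have hχp : ∀ j x, x ∉ tsupport χ → partialD j χ x = 0 := fun j x hx =>
    partialD_eq_zero_of_notMem_tsupport hx j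
  have hBc : ∀ j, Continuous (B j) := by
    intro j
    have := continuous_partialD hv j
    have := continuous_partialD hχ j
    have := continuous_partialD (hφ.of_le one_le_two) j
    simp only [hB]
    fun_prop
  have hBs : ∀ j, HasCompactSupport (B j) := fun j => HasCompactSupport.intro hχc fun x hx => by
    simp [hB, hχz x hx, hχp j x hx]
  set u : Cn n → ℂ := fun z => (Real.exp (-φ z / 2) * χ z) • v z with hu
  have hu1 : ContDiff ℝ 1 u := by
    have := hφ.of_le (one_le_two : (1 : WithTop ℕ∞) ≤ 2)
    exact ((this.neg.div_const 2).exp.mul hχ).smul hv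
  have hus : HasCompactSupport u := HasCompactSupport.intro hχc fun x hx => by
    simp [hu, hχz x hx]
  have hexp : ∀ z, ‖Real.exp (-φ z / 2)‖ ^ 2 = Real.exp (-φ z) := by
    intro z
    rw [Real.norm_of_nonneg (Real.exp_pos _).le, sq, ← Real.exp_add]
    congr 1; ring
  have hunorm : ∀ z, ‖u z‖ ^ 2 = Real.exp (-φ z) * ‖χ z • v z‖ ^ 2 := by
    intro z
    simp only [hu]
    rw [mul_smul, norm_smul, mul_pow, hexp]
  have main := integral_potential_mul_le hφ η hε hu1 hus
  have hDB : ∀ j, ∫ z, ‖partialD j u z - (η / 2 * partialD j φ z) • u z‖ ^ 2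
      = ∫ z, Real.exp (-φ z) * ‖B j z‖ ^ 2 := by
    intro j
    refine integral_congr_ae (Eventually.of_forall fun z => ?_)
    simp only [hu]
    rw [partialD_conj_weight hφ η hχ hv j z, norm_smul, mul_pow, hexp]
  simp only [hDB] at main
  have hχv : HasCompactSupport fun z => χ z • v z := HasCompactSupport.intro hχc fun x hx => by
    simp [hχz x hx]
  have hwv : HasCompactSupport fun z => (√(potential φ η ε z + K) * χ z) • v z :=
    HasCompactSupport.intro hχc fun x hx => by simp [hχz x hx]
  have hint : ∀ f : Cn n → ℝ, Continuous f → (∀ x, x ∉ tsupport χ → f x = 0) → Integrable f :=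
    fun f hf h0 => hf.integrable_of_hasCompactSupport (HasCompactSupport.intro hχc h0)
  have hsq : eLpNorm (fun z => (√(potential φ η ε z + K) * χ z) • v z) 2 (weight φ) ^ 2 ≤
      ENNReal.ofReal C * ∑ j, eLpNorm (B j) 2 (weight φ) ^ 2
        + ENNReal.ofReal K * eLpNorm (fun z => χ z • v z) 2 (weight φ) ^ 2 := by
    rw [eLpNorm_weight_sq hφc (by fun_prop) hwv, eLpNorm_weight_sq hφc (by fun_prop) hχv]
    simp only [fun j => eLpNorm_weight_sq hφc (hBc j) (hBs j)]
    rw [← ENNReal.ofReal_sum_of_nonneg fun j _ => integral_nonneg fun z => by positivity,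
      ← ENNReal.ofReal_mul (by positivity), ← ENNReal.ofReal_mul (by positivity),
      ← ENNReal.ofReal_add
        (mul_nonneg (by positivity) (Finset.sum_nonneg fun j _ =>
          integral_nonneg fun z => by positivity))
        (mul_nonneg (by positivity) (integral_nonneg fun z => by positivity))]
    refine ENNReal.ofReal_le_ofReal ?_
    have e : ∫ z, Real.exp (-φ z) * ‖(√(potential φ η ε z + K) * χ z) • v z‖ ^ 2 =
        (∫ z, potential φ η ε z * ‖u z‖ ^ 2)
          + K * ∫ z, Real.exp (-φ z) * ‖χ z • v z‖ ^ 2 := by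
      rw [← integral_const_mul, ← integral_add]
      · refine integral_congr_ae (Eventually.of_forall fun z => ?_)
        simp only
        rw [hunorm, mul_smul, norm_smul, mul_pow, Real.norm_of_nonneg (Real.sqrt_nonneg _),
          Real.sq_sqrt (hK z)]
        ring
      · have := hu1.continuous
        exact hint _ (by fun_prop) fun x hx => by simp [hu, hχz x hx]
      · exact hint _ (by fun_prop) fun x hx => by simp [hχz x hx]
    rw [e]
    gcongr
  -- Square roots of constants are avoided: as `C, K ≥ 1`, each is at most its square, and sums of
  -- squares are at most squares of sums.
  refine (ENNReal.pow_le_pow_left_iff two_ne_zero).1 (hsq.trans ?_)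
  have hsqle : ∀ {c : ℝ}, 1 ≤ c → ENNReal.ofReal c ≤ ENNReal.ofReal c ^ 2 := fun hc =>
    le_self_pow₀ (by simpa using hc) two_ne_zero
  calc _ ≤ (ENNReal.ofReal C * ∑ j, eLpNorm (B j) 2 (weight φ)) ^ 2
        + (ENNReal.ofReal K * eLpNorm (fun z => χ z • v z) 2 (weight φ)) ^ 2 := by
        rw [mul_pow, mul_pow]
        gcongr
        · exact hsqle hC1
        · exact sum_sq_le_sq_sum_ennreal _ _
        · exact hsqle hK1
    _ ≤ _ := by
        rw [add_sq]
        gcongr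
        exact le_self_add

/-! ### Weak derivatives in the basic estimate, and control of the tails. -/

variable {n : ℕ}

theorem exists_enorm_le_on_closedBall {a : Cn n → ℝ} (ha : Continuous a) (R : ℝ) :
    ∃ M : ℝ≥0, ∀ z ∈ Metric.closedBall (0 : Cn n) R, ‖a z‖ₑ ≤ M := by
  obtain ⟨C, hC⟩ := (isCompact_closedBall (0 : Cn n) R).exists_bound_of_continuousOn ha.continuousOn
  refine ⟨C.toNNReal, fun z hz => ?_⟩
  rw [enorm_le_coe, ← NNReal.coe_le_coe, coe_nnnorm]
  exact (hC z hz).trans (Real.le_coe_toNNReal C)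

theorem exists_eLpNorm_smul_le {a : Cn n → ℝ} (ha : Continuous a) (R : ℝ) :
    ∃ M : ℝ≥0, ∀ f : Cn n → ℂ,
      eLpNorm (fun z => a z • f z) 2 (volume.restrict (Metric.closedBall 0 R)) ≤
        M * eLpNorm f 2 (volume.restrict (Metric.closedBall 0 R)) := by
  obtain ⟨M, hM⟩ := exists_enorm_le_on_closedBall ha R
  refine ⟨M, fun f => eLpNorm_two_le_of_lintegral_sq_le ?_⟩
  rw [mul_pow, eLpNorm_two_sq, ← lintegral_const_mul' _ _ (by simp)]
  refine setLIntegral_mono' Metric.isClosed_closedBall.measurableSet fun z hz => ?_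
  rw [enorm_smul, mul_pow]
  gcongr
  exact hM z hz

/-- With the next lemma: on a ball `e^{-φ}` lies between positive constants, so weighted and
unweighted `L²` norms are comparable there. -/
theorem exists_eLpNorm_weight_restrict_le {φ : Cn n → ℝ} (hφ : Continuous φ) (R : ℝ) :
    ∃ M : ℝ≥0, ∀ f : Cn n → ℂ,
      eLpNorm f 2 ((weight φ).restrict (Metric.closedBall 0 R)) ≤
        M * eLpNorm f 2 (volume.restrict (Metric.closedBall 0 R)) := by
  obtain ⟨M, hM⟩ := exists_eLpNorm_smul_le (a := fun z => Real.exp (-φ z / 2)) (by fun_prop) R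
  refine ⟨M, fun f => (eLpNorm_two_le_of_lintegral_sq_le (le_of_eq ?_)).trans (hM f)⟩
  rw [eLpNorm_two_sq, weight, restrict_withDensity Metric.isClosed_closedBall.measurableSet,
    lintegral_withDensity_eq_lintegral_mul_non_measurable _ (by fun_prop) (by simp)]
  refine lintegral_congr fun z => ?_
  rw [enorm_smul, mul_pow, Real.enorm_of_nonneg (Real.exp_pos _).le,
    ← ENNReal.ofReal_pow (Real.exp_pos _).le, sq (Real.exp _), ← Real.exp_add, Pi.mul_apply]
  congr 4
  ring

theorem exists_eLpNorm_restrict_le_weight {φ : Cn n → ℝ} (hφ : Continuous φ) (R : ℝ) :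
    ∃ M : ℝ≥0, ∀ f : Cn n → ℂ,
      eLpNorm f 2 (volume.restrict (Metric.closedBall 0 R)) ≤ M * eLpNorm f 2 (weight φ) := by
  obtain ⟨M, hM⟩ := exists_enorm_le_on_closedBall (a := fun z => Real.exp (φ z / 2)) (by fun_prop) R
  refine ⟨M, fun f => eLpNorm_two_le_of_lintegral_sq_le ?_⟩
  rw [mul_pow, eLpNorm_two_sq, lintegral_weight hφ, ← lintegral_const_mul' _ _ (by simp)]
  refine le_trans (setLIntegral_mono' Metric.isClosed_closedBall.measurableSet fun z hz => ?_)
    (setLIntegral_le_lintegral _ _)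
  have h1 : (1 : ℝ≥0∞) = ‖Real.exp (φ z / 2)‖ₑ ^ 2 * ENNReal.ofReal (Real.exp (-φ z)) := by
    rw [Real.enorm_of_nonneg (Real.exp_pos _).le, ← ENNReal.ofReal_pow (Real.exp_pos _).le,
      ← ENNReal.ofReal_mul (by positivity), sq, ← Real.exp_add, ← Real.exp_add]
    simp
  calc ‖f z‖ₑ ^ 2 = ‖Real.exp (φ z / 2)‖ₑ ^ 2 * ENNReal.ofReal (Real.exp (-φ z)) * ‖f z‖ₑ ^ 2 := by
        rw [← h1, one_mul]
    _ ≤ _ := by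
        rw [mul_assoc]
        gcongr
        exact hM z hz

/-- Multiplication by a continuous function supported in a ball maps `L²` of that ball to the
weighted space. -/
theorem exists_eLpNorm_weight_smul_le {φ : Cn n → ℝ} (hφ : Continuous φ) {a : Cn n → ℝ}
    (ha : Continuous a) {R : ℝ} (hR : ∀ z, z ∉ Metric.closedBall (0 : Cn n) R → a z = 0) :
    ∃ M : ℝ≥0, ∀ f : Cn n → ℂ, eLpNorm (fun z => a z • f z) 2 (weight φ) ≤
      M * eLpNorm f 2 (volume.restrict (Metric.closedBall 0 R)) := by
  obtain ⟨M₁, h₁⟩ := exists_eLpNorm_weight_restrict_le hφ R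
  obtain ⟨M₂, h₂⟩ := exists_eLpNorm_smul_le ha R
  refine ⟨M₁ * M₂, fun f => ?_⟩
  have e : (fun z => a z • f z) =
      (Metric.closedBall (0 : Cn n) R).indicator fun z => a z • f z := by
    refine (Set.indicator_eq_self.2 fun z hz => ?_).symm
    by_contra hzR
    exact hz (by simp [hR z hzR])
  rw [e, eLpNorm_indicator_eq_eLpNorm_restrict Metric.isClosed_closedBall.measurableSet]
  refine (h₁ _).trans ?_
  rw [ENNReal.coe_mul, mul_assoc]
  gcongr
  exact h₂ f

/-- On balls the weight is bounded below and `∂_jφ` is bounded, so moving the zeroth order term to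
the other side keeps everything locally square integrable. -/
theorem HasWeakPartials.of_isTwistedDeriv {φ : Cn n → ℝ} (hφ : ContDiff ℝ 2 φ) {η : ℝ} {h : L2 φ}
    {g : Fin n ⊕ Fin n → L2 φ} (H : ∀ j, IsTwistedDeriv φ η j h (g j)) :
    HasWeakPartials h fun j z => g j z + ((1 + η) / 2 * partialD j φ z) • h z := by
  have hmem : ∀ (f : L2 φ) (R : ℝ), MemLp f 2 (volume.restrict (Metric.closedBall 0 R)) := by
    intro f R
    obtain ⟨M, hM⟩ := exists_eLpNorm_restrict_le_weight hφ.continuous R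
    refine ⟨(Lp.stronglyMeasurable f).aestronglyMeasurable, (hM f).trans_lt ?_⟩
    exact ENNReal.mul_lt_top ENNReal.coe_lt_top (Lp.memLp f).2
  have hp : ∀ j, Continuous (partialD j φ) := continuous_partialD (hφ.of_le one_le_two)
  refine ⟨hmem h, fun j R => (hmem _ R).add ?_, fun j ψ hψ hc => ?_⟩
  · have hcont : Continuous fun z => (1 + η) / 2 * partialD j φ z := by
      have := hp j
      fun_prop
    obtain ⟨M, hM⟩ := exists_eLpNorm_smul_le hcont R
    refine ⟨hcont.aestronglyMeasurable.smul (hmem h R).1, (hM h).trans_lt ?_⟩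
    exact ENNReal.mul_lt_top ENNReal.coe_lt_top (hmem h R).2
  · have e1 := H j ψ hψ hc
    have e2 : ∫ z, (g j z + ((1 + η) / 2 * partialD j φ z) • h z) * ψ z =
        (∫ z, g j z * ψ z) + ∫ z, (((1 + η) / 2 * partialD j φ z : ℝ) : ℂ) * h z * ψ z := by
      rw [← integral_add (integrable_mul hφ.continuous (g j) hψ.continuous hc)
        (integrable_test₂ hφ η h j hψ hc)]
      refine integral_congr_ae (Eventually.of_forall fun z => ?_)
      simp only [Complex.real_smul]
      ring
    rw [e2, ← e1]
    ring

/-- The basic estimate for functions with weak derivatives. -/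
theorem HasWeakPartials.eLpNorm_weight_le {φ : Cn n → ℝ} (hφ : ContDiff ℝ 2 φ) (η : ℝ) {ε K : ℝ}
    (hε : 0 < ε) (hK1 : 1 ≤ K) (hK : ∀ z, 0 ≤ potential φ η ε z + K) {χ : Cn n → ℝ}
    (hχ : ContDiff ℝ 1 χ) (hχc : HasCompactSupport χ) {h : Cn n → ℂ}
    {H : Fin n ⊕ Fin n → Cn n → ℂ} (hh : HasWeakPartials h H) (hm : StronglyMeasurable h)
    (hHm : ∀ j, StronglyMeasurable (H j)) :
    eLpNorm (fun z => (√(potential φ η ε z + K) * χ z) • h z) 2 (weight φ) ≤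
      ENNReal.ofReal ((1 + ε) ^ 2 / ε) * ∑ j, eLpNorm (fun z => χ z • H j z
        + (partialD j χ z - (1 + η) / 2 * partialD j φ z * χ z) • h z) 2 (weight φ)
      + ENNReal.ofReal K * eLpNorm (fun z => χ z • h z) 2 (weight φ) := by
  have hφc := hφ.continuous
  have hχcont := hχ.continuous
  have hVc := continuous_potential hφ η ε
  obtain ⟨R, hR⟩ : ∃ R : ℝ, tsupport χ ⊆ Metric.closedBall 0 R :=
    (hχc.isBounded).subset_closedBall 0
  have hχz : ∀ x, x ∉ tsupport χ → χ x = 0 := fun x hx => image_eq_zero_of_notMem_tsupport hx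
  have hχp : ∀ j x, x ∉ tsupport χ → partialD j χ x = 0 := fun j x hx =>
    partialD_eq_zero_of_notMem_tsupport hx j
  -- All coefficients contain `χ` or its derivative and vanish off the ball of radius `R`, so
  -- weighted errors are controlled by the unweighted approximation error on that ball.
  set a : Cn n → ℝ := fun z => √(potential φ η ε z + K) * χ z with ha
  set b : Fin n ⊕ Fin n → Cn n → ℝ :=
    fun j z => partialD j χ z - (1 + η) / 2 * partialD j φ z * χ z with hb
  have hac : Continuous a := by simp only [ha]; fun_prop
  have hbc : ∀ j, Continuous (b j) := by
    intro j
    have := continuous_partialD hχ j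
    have := continuous_partialD (hφ.of_le one_le_two) j
    simp only [hb]
    fun_prop
  obtain ⟨Ma, hMa⟩ := exists_eLpNorm_weight_smul_le hφc hac (R := R) fun z hz => by
    simp [ha, hχz z fun hz' => hz (hR hz')]
  obtain ⟨Mχ, hMχ⟩ := exists_eLpNorm_weight_smul_le hφc hχcont (R := R) fun z hz =>
    hχz z fun hz' => hz (hR hz')
  choose Mb hMb using fun j => exists_eLpNorm_weight_smul_le hφc (hbc j) (R := R) fun z hz => by
    simp [hb, hχz z fun hz' => hz (hR hz'), hχp j z fun hz' => hz (hR hz')]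
  set C := ENNReal.ofReal ((1 + ε) ^ 2 / ε)
  set N : Fin n ⊕ Fin n → ℝ≥0∞ := fun j => eLpNorm (fun z => χ z • H j z + b j z • h z) 2 (weight φ)
  set N₀ : ℝ≥0∞ := eLpNorm (fun z => χ z • h z) 2 (weight φ)
  have key : ∀ θ : ℝ≥0∞, 0 < θ → eLpNorm (fun z => a z • h z) 2 (weight φ) ≤
      C * ∑ j, (N j + Mχ * θ + Mb j * θ) + ENNReal.ofReal K * (N₀ + Mχ * θ) + Ma * θ := by
    intro θ hθ
    obtain ⟨v, hv, hv0, hvj⟩ := hh.exists_smooth_approx R hθ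
    have hv1 : ContDiff ℝ 1 v := hv.of_le (by norm_cast)
    have hvm : StronglyMeasurable v := hv.continuous.stronglyMeasurable
    have hpm : ∀ j, StronglyMeasurable (partialD j v) := fun j =>
      (continuous_partialD hv1 j).stronglyMeasurable
    have hχm : StronglyMeasurable χ := hχcont.stronglyMeasurable
    have ham : StronglyMeasurable a := hac.stronglyMeasurable
    have hbm : ∀ j, StronglyMeasurable (b j) := fun j => (hbc j).stronglyMeasurable
    have e1 : (fun z => a z • h z) = (fun z => a z • v z) - fun z => a z • (v z - h z) := by
      ext z
      simp only [Pi.sub_apply, smul_sub]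
      ring
    rw [e1]
    refine (eLpNorm_sub_le (ham.smul hvm).aestronglyMeasurable
      (ham.smul (hvm.sub hm)).aestronglyMeasurable (by norm_num)).trans ?_
    refine add_le_add ((eLpNorm_weight_le_of_contDiff hφ η hε hK1 hK hχ hχc hv1).trans ?_)
      ((hMa _).trans ?_)
    · refine add_le_add ?_ ?_
      · gcongr with j
        have e2 : (fun z => χ z • partialD j v z
            + (partialD j χ z - (1 + η) / 2 * partialD j φ z * χ z) • v z) =
            ((fun z => χ z • H j z + b j z • h z) + fun z => χ z • (partialD j v z - H j z))
              + fun z => b j z • (v z - h z) := by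
          ext z
          simp only [Pi.add_apply, smul_sub, hb]
          ring
        have m1 := (hχm.smul (hHm j)).add ((hbm j).smul hm)
        have m2 := hχm.smul ((hpm j).sub (hHm j))
        have m3 := (hbm j).smul (hvm.sub hm)
        rw [e2]
        refine (eLpNorm_add_le (m1.add m2).aestronglyMeasurable m3.aestronglyMeasurable
          (by norm_num)).trans (add_le_add ?_ ((hMb j _).trans ?_))
        · refine (eLpNorm_add_le m1.aestronglyMeasurable m2.aestronglyMeasurable
            (by norm_num)).trans (add_le_add le_rfl ((hMχ _).trans ?_))
          gcongr
          exact hvj j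
        · gcongr
          exact hv0
      · gcongr
        have e3 : (fun z => χ z • v z) = (fun z => χ z • h z) + fun z => χ z • (v z - h z) := by
          ext z
          simp only [Pi.add_apply, smul_sub]
          ring
        rw [e3]
        refine (eLpNorm_add_le (hχm.smul hm).aestronglyMeasurable
          (hχm.smul (hvm.sub hm)).aestronglyMeasurable (by norm_num)).trans
          (add_le_add le_rfl ((hMχ _).trans ?_))
        gcongr
        exact hv0
    · gcongr
      exact hv0
  have hlim : Tendsto (fun θ : ℝ≥0∞ =>
      C * ∑ j, (N j + Mχ * θ + Mb j * θ) + ENNReal.ofReal K * (N₀ + Mχ * θ) + Ma * θ)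
      (𝓝[>] 0) (𝓝 (C * ∑ j, (N j + Mχ * 0 + Mb j * 0) + ENNReal.ofReal K * (N₀ + Mχ * 0)
        + Ma * 0)) := by
    refine tendsto_nhdsWithin_of_tendsto_nhds ?_
    have hM : ∀ M : ℝ≥0, Tendsto (fun θ : ℝ≥0∞ => M * θ) (𝓝 0) (𝓝 (M * 0)) := fun M =>
      ENNReal.Tendsto.const_mul tendsto_id (Or.inr (by simp))
    refine Tendsto.add (Tendsto.add ?_ ?_) (hM Ma)
    · refine ENNReal.Tendsto.const_mul ?_ (Or.inr ENNReal.ofReal_ne_top)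
      exact tendsto_finsetSum _ fun j _ => (tendsto_const_nhds.add (hM Mχ)).add (hM (Mb j))
    · exact ENNReal.Tendsto.const_mul (tendsto_const_nhds.add (hM Mχ))
        (Or.inr ENNReal.ofReal_ne_top)
  have := ge_of_tendsto hlim (eventually_mem_nhdsWithin.mono fun θ hθ => key θ hθ)
  simpa only [mul_zero, add_zero] using this

/-- Cutoff functions at all scales with uniformly bounded derivatives. -/
theorem exists_cutoff (n : ℕ) : ∃ L : ℝ≥0, ∀ R : ℝ, 1 ≤ R → ∃ χ : Cn n → ℝ, ContDiff ℝ 1 χ ∧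
    HasCompactSupport χ ∧ (∀ z, ‖χ z‖ₑ ≤ 1) ∧ (∀ z ∈ Metric.closedBall 0 R, χ z = 1) ∧
    ∀ j z, ‖partialD j χ z‖ₑ ≤ L := by
  let f : ContDiffBump (0 : Cn n) := ⟨1, 2, one_pos, one_lt_two⟩
  have hf : ContDiff ℝ 1 f := f.contDiff
  obtain ⟨L, hL⟩ := (hf.continuous_fderiv one_ne_zero).bounded_above_of_compact_support
    (f.hasCompactSupport.fderiv ℝ)
  -- Rescaling one fixed bump multiplies its derivative by `R⁻¹ ≤ 1`, so a single bound serves all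
  -- `R`.
  refine ⟨L.toNNReal, fun R hR => ⟨fun z => f (R⁻¹ • z), ?_, ?_, ?_, ?_, ?_⟩⟩
  · exact hf.comp (contDiff_const_smul _)
  · exact f.hasCompactSupport.comp_smul (by positivity)
  · intro z
    rw [Real.enorm_of_nonneg f.nonneg]
    simpa using f.le_one
  · intro z hz
    refine f.one_of_mem_closedBall ?_
    rw [Metric.mem_closedBall, dist_zero_right] at hz ⊢
    rw [norm_smul, norm_inv, Real.norm_of_nonneg (by positivity), inv_mul_le_iff₀ (by positivity)]
    change ‖z‖ ≤ R * 1
    linarith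
  · intro j z
    have h1 : HasFDerivAt (fun z : Cn n => R⁻¹ • z) (R⁻¹ • ContinuousLinearMap.id ℝ (Cn n)) z :=
      (hasFDerivAt_id z).const_smul R⁻¹
    have h2 := ((hf.differentiable one_ne_zero (R⁻¹ • z)).hasFDerivAt.comp z h1).fderiv
    have h3 : partialD j (fun z => f (R⁻¹ • z)) z =
        fderiv ℝ (f ∘ fun z => R⁻¹ • z) z (coordDir j) := rfl
    rw [enorm_le_coe, ← NNReal.coe_le_coe, coe_nnnorm, h3, h2]
    refine le_trans ?_ (Real.le_coe_toNNReal L)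
    simp only [ContinuousLinearMap.comp_apply, smul_apply, ContinuousLinearMap.id_apply, map_smul,
      norm_smul, norm_inv, Real.norm_of_nonneg (zero_le_one.trans hR)]
    calc R⁻¹ * ‖fderiv ℝ f (R⁻¹ • z) (coordDir j)‖
        ≤ 1 * ‖fderiv ℝ f (R⁻¹ • z) (coordDir j)‖ := by
          gcongr
          exact inv_le_one_of_one_le₀ hR
      _ ≤ ‖fderiv ℝ f (R⁻¹ • z)‖ * ‖(coordDir j : Cn n)‖ := by
          rw [one_mul]
          exact ContinuousLinearMap.le_opNorm _ _
      _ ≤ L := by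
          rw [norm_coordDir, mul_one]
          exact hL _

theorem exists_potential_bounded_below {φ : Cn n → ℝ} (hφ : ContDiff ℝ 2 φ) {η ε : ℝ}
    (hlim : Tendsto (potential φ η ε) (Bornology.cobounded (Cn n)) atTop) :
    ∃ K : ℝ, 1 ≤ K ∧ ∀ z, 0 ≤ potential φ η ε z + K := by
  obtain ⟨r, -, hr⟩ := Metric.hasBasis_cobounded_compl_closedBall (0 : Cn n) |>.eventually_iff.1
    (hlim.eventually_ge_atTop 0)
  obtain ⟨M, hM⟩ := (isCompact_closedBall (0 : Cn n) r).exists_bound_of_continuousOn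
    (continuous_potential hφ η ε).continuousOn
  refine ⟨max 1 M, le_max_left _ _, fun z => ?_⟩
  by_cases hz : z ∈ Metric.closedBall (0 : Cn n) r
  · have := abs_le.1 (hM z hz)
    linarith [le_max_right 1 M]
  · linarith [hr hz, le_max_left 1 M]

/-- Monotone convergence along exhausting balls; it removes the cutoff from bounds that are uniform
in its radius. -/
theorem eLpNorm_restrict_le_of_inter_closedBall {μ : Measure (Cn n)} (f : Cn n → ℂ) (S : Set (Cn n))
    {A : ℝ≥0∞} (h : ∀ m : ℕ, eLpNorm f 2 (μ.restrict (S ∩ Metric.closedBall 0 (m + 1))) ≤ A) :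
    eLpNorm f 2 (μ.restrict S) ≤ A := by
  have hU : S = ⋃ m : ℕ, S ∩ Metric.closedBall (0 : Cn n) (m + 1) := by
    rw [← Set.inter_iUnion]
    refine (Set.inter_eq_left.2 fun z _ => ?_).symm
    obtain ⟨m, hm⟩ := exists_nat_ge ‖z‖
    refine Set.mem_iUnion.2 ⟨m, ?_⟩
    rw [Metric.mem_closedBall, dist_zero_right]
    linarith
  have hdir : Directed (· ⊆ ·) fun m : ℕ => S ∩ Metric.closedBall (0 : Cn n) (m + 1) := by
    refine Monotone.directed_le fun a b hab => ?_
    refine Set.inter_subset_inter_right _ (Metric.closedBall_subset_closedBall ?_)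
    have : (a : ℝ) ≤ b := by exact_mod_cast hab
    linarith
  refine eLpNorm_two_le_of_lintegral_sq_le ?_
  rw [hU, setLIntegral_iUnion_of_directed _ hdir]
  refine iSup_le fun m => ?_
  rw [← eLpNorm_two_sq]
  gcongr
  exact h m

/-- The mass of a function outside large balls is controlled by its Sobolev norm. -/
theorem exists_tail_bound {φ : Cn n → ℝ} (hφ : ContDiff ℝ 2 φ) {η ε : ℝ} (hε : 0 < ε)
    (hlim : Tendsto (potential φ η ε) (Bornology.cobounded (Cn n)) atTop) :
    ∃ C : ℝ≥0, ∀ N : ℝ≥0, ∃ r : ℝ, ∀ (h : L2 φ) (g : Fin n ⊕ Fin n → L2 φ),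
      (∀ j, IsTwistedDeriv φ η j h (g j)) →
      N * eLpNorm h 2 ((weight φ).restrict (Metric.closedBall 0 r)ᶜ) ≤
        C * (eLpNorm h 2 (weight φ) + ∑ j, eLpNorm (g j) 2 (weight φ)) := by
  obtain ⟨K, hK1, hK⟩ := exists_potential_bounded_below hφ hlim
  obtain ⟨L, hL⟩ := exists_cutoff n
  set C₁ : ℝ≥0 := ((1 + ε) ^ 2 / ε).toNNReal with hC₁
  set J : ℝ≥0 := (Fintype.card (Fin n ⊕ Fin n) : ℝ≥0)
  refine ⟨C₁ + C₁ * J * L + K.toNNReal, fun N => ?_⟩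
  -- Outside this ball the potential is at least `N²`, hence `√(potential + K) ≥ N`. Only `r`
  -- depends on `N`; the constant does not.
  obtain ⟨r, -, hr⟩ := Metric.hasBasis_cobounded_compl_closedBall (0 : Cn n) |>.eventually_iff.1
    (hlim.eventually_ge_atTop ((N : ℝ) ^ 2))
  refine ⟨r, fun h g H => ?_⟩
  set A := eLpNorm h 2 (weight φ) with hA
  set G := fun j => eLpNorm (g j) 2 (weight φ) with hG
  have hw := HasWeakPartials.of_isTwistedDeriv hφ H
  have hm := Lp.stronglyMeasurable h
  have hgm := fun j => Lp.stronglyMeasurable (g j)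
  have bound : ∀ (a : Cn n → ℝ) (M : ℝ≥0) (f : Cn n → ℂ), (∀ z, ‖a z‖ₑ ≤ M) →
      eLpNorm (fun z => a z • f z) 2 (weight φ) ≤ M * eLpNorm f 2 (weight φ) := by
    intro a M f ha
    refine eLpNorm_two_le_of_lintegral_sq_le ?_
    rw [mul_pow, eLpNorm_two_sq, ← lintegral_const_mul' _ _ (by simp)]
    refine lintegral_mono fun z => ?_
    rw [enorm_smul, mul_pow]
    gcongr
    exact ha z
  have hfin : ∀ m : ℕ, N * eLpNorm h 2 ((weight φ).restrict
      ((Metric.closedBall 0 r)ᶜ ∩ Metric.closedBall 0 (m + 1))) ≤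
      (C₁ + C₁ * J * L + K.toNNReal : ℝ≥0) * (A + ∑ j, G j) := by
    intro m
    obtain ⟨χ, hχ, hχc, hχ1, hχR, hχL⟩ := hL (m + 1) (by linarith [m.cast_nonneg (α := ℝ)])
    have hcm : ∀ j, StronglyMeasurable fun z => (1 + η) / 2 * partialD j φ z := fun j => by
      have := continuous_partialD (hφ.of_le one_le_two) j
      exact Continuous.stronglyMeasurable (by fun_prop)
    have main := hw.eLpNorm_weight_le hφ η hε hK1 hK hχ hχc hm
      fun j => (hgm j).add ((hcm j).smul hm)
    have hlow : N * eLpNorm h 2 ((weight φ).restrict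
        ((Metric.closedBall 0 r)ᶜ ∩ Metric.closedBall 0 (m + 1))) ≤
        eLpNorm (fun z => (√(potential φ η ε z + K) * χ z) • h z) 2 (weight φ) := by
      refine (ENNReal.pow_le_pow_left_iff two_ne_zero).1 ?_
      rw [mul_pow, eLpNorm_two_sq, eLpNorm_two_sq, ← lintegral_const_mul' _ _ (by simp)]
      refine le_trans (setLIntegral_mono' (Metric.isClosed_closedBall.measurableSet.compl.inter
        Metric.isClosed_closedBall.measurableSet) fun z hz => ?_) (setLIntegral_le_lintegral _ _)
      rw [hχR z hz.2, mul_one, enorm_smul, mul_pow]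
      gcongr
      rw [Real.enorm_of_nonneg (Real.sqrt_nonneg _), ← ENNReal.ofReal_coe_nnreal]
      refine ENNReal.ofReal_le_ofReal (Real.le_sqrt_of_sq_le ?_)
      linarith [hr hz.1]
    refine hlow.trans (main.trans ?_)
    have hB : ∀ j, eLpNorm (fun z => χ z • (g j z + ((1 + η) / 2 * partialD j φ z) • h z)
        + (partialD j χ z - (1 + η) / 2 * partialD j φ z * χ z) • h z) 2 (weight φ) ≤
        G j + L * A := by
      intro j
      -- The terms with `∂_jφ`, unbounded in general, cancel; what remains is the twisted derivative
      -- and the bounded `∂_jχ`.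
      have e : (fun z => χ z • (g j z + ((1 + η) / 2 * partialD j φ z) • h z)
          + (partialD j χ z - (1 + η) / 2 * partialD j φ z * χ z) • h z) =
          (fun z => χ z • g j z) + fun z => partialD j χ z • h z := by
        ext z
        simp only [Pi.add_apply, Complex.real_smul]
        push_cast
        ring
      rw [e]
      refine (eLpNorm_add_le (hχ.continuous.stronglyMeasurable.smul (hgm j)).aestronglyMeasurable
        ((continuous_partialD hχ j).stronglyMeasurable.smul hm).aestronglyMeasurable
        (by norm_num)).trans (add_le_add ?_ (bound _ L _ (hχL j)))
      exact (bound χ 1 (g j) (by simpa using hχ1)).trans (by rw [ENNReal.coe_one, one_mul])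
    have hh0 : eLpNorm (fun z => χ z • h z) 2 (weight φ) ≤ A := by
      simpa only [ENNReal.coe_one, one_mul] using bound χ 1 h (by simpa using hχ1)
    calc _ ≤ (C₁ : ℝ≥0∞) * ∑ j, (G j + L * A) + (K.toNNReal : ℝ≥0∞) * A := by
          refine add_le_add ?_ ?_
          · exact mul_le_mul_right (Finset.sum_le_sum fun j _ => hB j) _
          · exact mul_le_mul_right hh0 _
      _ = C₁ * ∑ j, G j + (C₁ * J * L) * A + K.toNNReal * A := by
          rw [Finset.sum_add_distrib, Finset.sum_const, Finset.card_univ, nsmul_eq_mul]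
          simp only [J, ENNReal.coe_natCast]
          ring
      _ ≤ (C₁ * ∑ j, G j + (C₁ * J * L) * A + K.toNNReal * A) +
          (C₁ * A + (C₁ * J * L) * ∑ j, G j + K.toNNReal * ∑ j, G j) := le_self_add
      _ = _ := by
          push_cast
          ring
  rcases eq_or_ne N 0 with rfl | hN
  · simp
  · have hN' : (N : ℝ≥0∞) ≠ 0 := by exact_mod_cast hN
    rw [mul_comm, ← ENNReal.le_div_iff_mul_le (Or.inl hN') (Or.inl ENNReal.coe_ne_top)]
    refine eLpNorm_restrict_le_of_inter_closedBall _ _ fun m => ?_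
    rw [ENNReal.le_div_iff_mul_le (Or.inl hN') (Or.inl ENNReal.coe_ne_top), mul_comm]
    exact hfin m

/-! ### Averaging as a compact operator. -/

variable {n : ℕ}

/-- The mean value over a ball, as a functional on the weighted space. -/
theorem exists_average_functional {φ : Cn n → ℝ} (hφ : Continuous φ) (p : Cn n) {δ : ℝ}
    (hδ : 0 < δ) : ∃ A : L2 φ →L[ℂ] ℂ, ∀ h : L2 φ, A h = ⨍ y in Metric.ball p δ, h y := by
  set V : ℝ≥0∞ := volume (Metric.ball p δ)
  have hV0 : V ≠ 0 := (Metric.measure_ball_pos volume _ hδ).ne'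
  have hVt : V ≠ ⊤ := measure_ball_lt_top.ne
  set ν : Measure (Cn n) := V⁻¹ • volume.restrict (Metric.ball p δ) with hν
  have : IsProbabilityMeasure ν := ⟨by
    rw [hν, Measure.smul_apply, Measure.restrict_apply_univ, smul_eq_mul,
      ENNReal.inv_mul_cancel hV0 hVt]⟩
  have havg : ∀ h : L2 φ, ⨍ y in Metric.ball p δ, h y = ∫ y, h y ∂ν := by
    intro h
    rw [average, Measure.restrict_apply_univ]
  obtain ⟨M, hM⟩ := exists_eLpNorm_restrict_le_weight hφ (‖p‖ + δ)
  have hle : volume.restrict (Metric.ball p δ) ≤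
      volume.restrict (Metric.closedBall 0 (‖p‖ + δ)) := by
    refine Measure.restrict_mono (fun y hy => ?_) le_rfl
    rw [Metric.mem_ball, dist_eq_norm] at hy
    rw [Metric.mem_closedBall, dist_zero_right]
    linarith [norm_sub_norm_le y p]
  have hball : ∀ h : L2 φ, eLpNorm h 2 (volume.restrict (Metric.ball p δ)) ≤ M * ‖h‖ₑ := fun h =>
    (eLpNorm_mono_measure _ hle).trans (by rw [Lp.enorm_def]; exact hM h)
  have hmeas : ∀ h : L2 φ, AEStronglyMeasurable h ν := fun h =>
    (Lp.stronglyMeasurable h).aestronglyMeasurable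
  have hint : ∀ h : L2 φ, Integrable h ν := by
    intro h
    refine memLp_one_iff_integrable.1 (MemLp.mono_exponent (q := 2) ?_ (by norm_num))
    refine MemLp.smul_measure ⟨(Lp.stronglyMeasurable h).aestronglyMeasurable,
      (hball h).trans_lt ?_⟩ (ENNReal.inv_ne_top.2 hV0)
    exact ENNReal.mul_lt_top ENNReal.coe_lt_top enorm_lt_top
  have hae : ∀ {q : Cn n → Prop}, (∀ᵐ z ∂(weight φ), q z) → ∀ᵐ z ∂ν, q z := fun hq =>
    Measure.ae_smul_measure (ae_restrict_of_ae (ae_volume_of_ae_weight hφ hq)) _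
  let A₀ : L2 φ →ₗ[ℂ] ℂ :=
    { toFun := fun h => ∫ y, h y ∂ν
      map_add' := fun h h' => by
        rw [← integral_add (hint h) (hint h')]
        exact integral_congr_ae (hae (Lp.coeFn_add h h'))
      map_smul' := fun c h => by
        rw [RingHom.id_apply, ← integral_smul]
        exact integral_congr_ae (hae (Lp.coeFn_smul c h)) }
  -- The added `1` gives `V⁻¹ ≤ (V⁻¹ + 1)²`, so no square root of `V⁻¹` is needed.
  set K : ℝ≥0 := (V⁻¹.toNNReal + 1) * M with hK
  refine ⟨A₀.mkContinuousOfExistsBound ⟨K, fun h => ?_⟩, fun h => (havg h).symm⟩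
  have hVi : ((V⁻¹.toNNReal : ℝ≥0) : ℝ≥0∞) = V⁻¹ := ENNReal.coe_toNNReal (ENNReal.inv_ne_top.2 hV0)
  have h1 : ‖A₀ h‖ₑ ≤ K * ‖h‖ₑ := by
    refine (ENNReal.pow_le_pow_left_iff two_ne_zero).1 ((enorm_integral_sq_le (hmeas h)).trans ?_)
    rw [lintegral_smul_measure, smul_eq_mul, ← eLpNorm_two_sq, hK, ENNReal.coe_mul, mul_assoc, mul_pow,
      ENNReal.coe_add, hVi, ENNReal.coe_one]
    gcongr
    · calc V⁻¹ ≤ V⁻¹ + 1 := le_self_add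
        _ ≤ _ := le_self_pow₀ le_add_self two_ne_zero
    · exact hball h
  have h2 := ENNReal.toReal_mono (by finiteness) h1
  rwa [ENNReal.toReal_mul, toReal_enorm, toReal_enorm, ENNReal.coe_toReal] at h2

/-- A rank one operator factors through the locally compact space `ℂ`. -/
theorem isCompactOperator_smulRight {X Y : Type*} [NormedAddCommGroup X] [NormedSpace ℂ X]
    [NormedAddCommGroup Y] [NormedSpace ℂ Y] (A : X →L[ℂ] ℂ) (c : Y) :
    IsCompactOperator (A.smulRight c) := by
  have hA : IsCompactOperator A := 
    isCompactOperator_of_locallyCompactSpace_dom A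
  exact hA.clm_comp (ContinuousLinearMap.toSpanSingleton ℂ c)

/-- Averaging over small balls is given by a compact operator. -/
theorem exists_compact_averaging {φ : Cn n → ℝ} (hφ : Continuous φ) (r : ℝ) {δ : ℝ} (hδ : 0 < δ)
    (s : SimpleFunc (Cn n) (Cn n)) : ∃ P : L2 φ →L[ℂ] L2 φ, IsCompactOperator P ∧ ∀ h : L2 φ,
      P h =ᵐ[weight φ] (Metric.closedBall 0 r).indicator
        fun x => ⨍ y in Metric.ball (s x) δ, h y := by
  classical
  have := weight_locallyFinite hφ
  choose A hA using fun p : Cn n => exists_average_functional hφ p hδ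
  set S : Cn n → Set (Cn n) := fun p => s ⁻¹' {p} ∩ Metric.closedBall 0 r with hS
  have hSm : ∀ p, MeasurableSet (S p) := fun p =>
    (s.measurableSet_fiber p).inter Metric.isClosed_closedBall.measurableSet
  have hSf : ∀ p, weight φ (S p) ≠ ⊤ := fun p =>
    ((measure_mono Set.inter_subset_right).trans_lt
      (isCompact_closedBall (0 : Cn n) r).measure_lt_top).ne
  -- One rank one term per value `p` of `s`: the mean over the ball about `p` times the indicator of
  -- the part of the fibre in the large ball. At each `x` only `p = s x` contributes.
  refine ⟨∑ p ∈ s.range, (A p).smulRight (indicatorConstLp 2 (hSm p) (hSf p) (1 : ℂ)), ?_,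
    fun h => ?_⟩
  · have : ∀ p, (A p).smulRight (indicatorConstLp 2 (hSm p) (hSf p) (1 : ℂ)) ∈
        compactOperator (RingHom.id ℂ) (L2 φ) (L2 φ) := fun p =>
      isCompactOperator_smulRight (A p) _
    exact Submodule.sum_mem _ fun p _ => this p
  · rw [sum_apply]
    have h1 : ∀ p, ((A p).smulRight (indicatorConstLp 2 (hSm p) (hSf p) (1 : ℂ))) h =ᵐ[weight φ]
        fun x => A p h * (S p).indicator (fun _ => 1) x := by
      intro p
      filter_upwards [Lp.coeFn_smul (A p h) (indicatorConstLp 2 (hSm p) (hSf p) (1 : ℂ)),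
        indicatorConstLp_coeFn (p := 2) (hs := hSm p) (hμs := hSf p) (c := (1 : ℂ))] with x hx hx'
      rw [ContinuousLinearMap.smulRight_apply, hx, Pi.smul_apply, hx', smul_eq_mul]
    refine (Lp.coeFn_fun_finsetSum _ _).trans ?_
    filter_upwards [(eventually_all_finset s.range).2 fun p _ => h1 p] with x hx
    rw [Finset.sum_congr rfl hx]
    by_cases hxr : x ∈ Metric.closedBall (0 : Cn n) r
    · rw [Set.indicator_of_mem hxr, Finset.sum_eq_single_of_mem (s x) (s.mem_range_self x)]
      · rw [Set.indicator_of_mem (show x ∈ S (s x) from ⟨rfl, hxr⟩), mul_one, hA]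
      · intro p _ hp
        rw [Set.indicator_of_notMem fun hxS => hp hxS.1.symm, mul_zero]
    · rw [Set.indicator_of_notMem hxr]
      refine Finset.sum_eq_zero fun p _ => ?_
      rw [Set.indicator_of_notMem fun hxS => hxr hxS.2, mul_zero]

/-- Up to a small error and the tails, the identity is a compact operator on functions with bounded
Sobolev norm. -/
theorem exists_compact_approx {φ : Cn n → ℝ} (hφ : ContDiff ℝ 2 φ) (η r : ℝ) {κ : ℝ≥0}
    (hκ : 0 < κ) : ∃ P : L2 φ →L[ℂ] L2 φ, IsCompactOperator P ∧
      ∀ (h : L2 φ) (g : Fin n ⊕ Fin n → L2 φ), (∀ j, IsTwistedDeriv φ η j h (g j)) →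
        ‖h - P h‖ₑ ≤ κ * (‖h‖ₑ + ∑ j, ‖g j‖ₑ) +
          eLpNorm h 2 ((weight φ).restrict (Metric.closedBall 0 r)ᶜ) := by
  have hφc := hφ.continuous
  have hcc : ∀ j, Continuous fun z => (1 + η) / 2 * partialD j φ z := fun j => by
    have := continuous_partialD (hφ.of_le one_le_two) j
    fun_prop
  obtain ⟨M₁, h₁⟩ := exists_eLpNorm_weight_restrict_le hφc r
  obtain ⟨M₂, h₂⟩ := exists_eLpNorm_restrict_le_weight hφc (r + 1)
  choose M₃ h₃ using fun j => exists_eLpNorm_smul_le (hcc j) (r + 1)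
  set d := Module.finrank ℝ (Cn n)
  set Q : ℝ≥0 := M₁ * 2 ^ d * (M₂ * (1 + ∑ j, M₃ j)) with hQ
  -- `τ` is twice the averaging radius: at most `1` for the local estimate, and with `Q τ ≤ κ`,
  -- where `Q` collects all constants. The `+ 1` guards against `Q = 0`.
  set τ : ℝ≥0 := min 1 (κ / (Q + 1)) with hτ
  have hτ0 : 0 < τ := lt_min one_pos (by positivity)
  have hQτ : Q * τ ≤ κ := by
    calc Q * τ ≤ (Q + 1) * (κ / (Q + 1)) := by
          gcongr
          · exact le_self_add
          · exact min_le_right _ _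
      _ = κ := mul_div_cancel₀ _ (by positivity)
  have hδ : 0 < (τ : ℝ) / 2 := by positivity
  have h2δ : 2 * ((τ : ℝ) / 2) = τ := by ring
  obtain ⟨s, hs⟩ := exists_simpleFunc_dist_lt (n := n) r hδ
  obtain ⟨P, hPc, hP⟩ := exists_compact_averaging hφc r hδ s
  refine ⟨P, hPc, fun h g H => ?_⟩
  have hw := HasWeakPartials.of_isTwistedDeriv hφ H
  have hm := Lp.stronglyMeasurable h
  set B : Set (Cn n) := Metric.closedBall 0 r
  have hB : MeasurableSet B := Metric.isClosed_closedBall.measurableSet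
  have hH : ∀ j, eLpNorm (fun z => g j z + ((1 + η) / 2 * partialD j φ z) • h z) 2
      (volume.restrict (Metric.closedBall 0 (r + 1))) ≤ M₂ * ‖g j‖ₑ + M₃ j * (M₂ * ‖h‖ₑ) := by
    intro j
    refine (eLpNorm_add_le (Lp.stronglyMeasurable (g j)).aestronglyMeasurable
      ((hcc j).stronglyMeasurable.smul hm).aestronglyMeasurable (by norm_num)).trans
      (add_le_add ?_ ((h₃ j h).trans ?_))
    · rw [Lp.enorm_def]
      exact h₂ (g j)
    · gcongr
      rw [Lp.enorm_def]
      exact h₂ h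
  have hsum : ∑ j, (M₂ * ‖g j‖ₑ + M₃ j * (M₂ * ‖h‖ₑ)) ≤
      (M₂ * (1 + ∑ j, M₃ j) : ℝ≥0) * (‖h‖ₑ + ∑ j, ‖g j‖ₑ) := by
    calc ∑ j, (M₂ * ‖g j‖ₑ + M₃ j * (M₂ * ‖h‖ₑ))
        = M₂ * ∑ j, ‖g j‖ₑ + (∑ j, (M₃ j : ℝ≥0∞)) * (M₂ * ‖h‖ₑ) := by
          rw [Finset.sum_add_distrib, ← Finset.mul_sum, ← Finset.sum_mul]
      _ ≤ (M₂ * ∑ j, ‖g j‖ₑ + (∑ j, (M₃ j : ℝ≥0∞)) * (M₂ * ‖h‖ₑ)) +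
          (M₂ * ‖h‖ₑ + (∑ j, (M₃ j : ℝ≥0∞)) * (M₂ * ∑ j, ‖g j‖ₑ)) := le_self_add
      _ = _ := by
          push_cast
          ring
  have hin : eLpNorm (fun x => h x - ⨍ y in Metric.ball (s x) (τ / 2), h y) 2
      ((weight φ).restrict B) ≤ κ * (‖h‖ₑ + ∑ j, ‖g j‖ₑ) := by
    calc _ ≤ (M₁ : ℝ≥0∞) * (2 ^ d * ENNReal.ofReal (2 * (τ / 2)) *
          ((M₂ * (1 + ∑ j, M₃ j) : ℝ≥0) * (‖h‖ₑ + ∑ j, ‖g j‖ₑ))) := by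
          refine (h₁ _).trans ?_
          gcongr
          refine (hw.eLpNorm_sub_average_le hm hδ (by rw [h2δ]; exact min_le_left _ _) hs).trans ?_
          gcongr
          exact (Finset.sum_le_sum fun j _ => hH j).trans hsum
      _ = (Q * τ : ℝ≥0) * (‖h‖ₑ + ∑ j, ‖g j‖ₑ) := by
          rw [h2δ, ENNReal.ofReal_coe_nnreal, hQ]
          push_cast
          ring
      _ ≤ _ := by
          gcongr
  rw [Lp.enorm_def]
  refine eLpNorm_two_le_of_lintegral_sq_le ?_
  have hae : ∀ᵐ x ∂(weight φ), (h - P h) x =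
      h x - B.indicator (fun x => ⨍ y in Metric.ball (s x) (τ / 2), h y) x := by
    filter_upwards [Lp.coeFn_sub h (P h), hP h] with x hx hx'
    rw [hx, Pi.sub_apply, hx']
  have e1 : ∫⁻ x in B, ‖(h - P h) x‖ₑ ^ 2 ∂(weight φ) =
      eLpNorm (fun x => h x - ⨍ y in Metric.ball (s x) (τ / 2), h y) 2
        ((weight φ).restrict B) ^ 2 := by
    rw [eLpNorm_two_sq]
    refine lintegral_congr_ae ?_
    filter_upwards [ae_restrict_of_ae hae, ae_restrict_mem hB] with x hx hxB
    rw [hx, Set.indicator_of_mem hxB]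
  have e2 : ∫⁻ x in Bᶜ, ‖(h - P h) x‖ₑ ^ 2 ∂(weight φ) =
      eLpNorm h 2 ((weight φ).restrict Bᶜ) ^ 2 := by
    rw [eLpNorm_two_sq]
    refine lintegral_congr_ae ?_
    filter_upwards [ae_restrict_of_ae hae, ae_restrict_mem hB.compl] with x hx hxB
    rw [hx, Set.indicator_of_notMem hxB, sub_zero]
  -- `P h` vanishes off `B`, so the error there is the tail of `h`; the two parts combine by `a² +
  -- b² ≤ (a + b)²`.
  rw [← lintegral_add_compl _ hB, e1, e2, add_sq]
  gcongr
  refine le_trans ?_ le_self_add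
  gcongr

theorem enorm_inclₗ_le {φ : Cn n → ℝ} (hφ : ContDiff ℝ 2 φ) (η : ℝ) (h : W1 hφ η) :
    ‖inclₗ hφ η h‖ₑ ≤ ‖h‖ₑ := by
  rw [enorm_le_iff_norm_le, norm_eq]
  exact Real.le_sqrt_of_sq_le (le_add_of_nonneg_right (by positivity))

theorem enorm_twistedD_le {φ : Cn n → ℝ} (hφ : ContDiff ℝ 2 φ) (η : ℝ) (j : Fin n ⊕ Fin n)
    (h : W1 hφ η) : ‖twistedD hφ η j h‖ₑ ≤ ‖h‖ₑ := by
  rw [enorm_le_iff_norm_le, norm_eq]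
  refine Real.le_sqrt_of_sq_le ((Finset.single_le_sum
    (f := fun j => ‖twistedD hφ η j h‖ ^ 2) (fun j _ => by positivity)
    (Finset.mem_univ j)).trans (le_add_of_nonneg_left (by positivity)))

end WeightedSobolev

/-! ### Compactness of the embedding. -/

open WeightedSobolev in
theorem isCompactOperator_embedding_of_tendsto {n : ℕ} {φ : Cn n → ℝ} (hφ : ContDiff ℝ 2 φ)
    {η ε : ℝ} (hε : 0 < ε)
    (hlim : Tendsto (potential φ η ε) (Bornology.cobounded (Cn n)) atTop) :
    IsCompactOperator (embedding hφ η) := by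
  obtain ⟨C, hC⟩ := exists_tail_bound hφ hε hlim
  -- Compact operators are closed in operator norm. The local and tail errors will each be at most
  -- `κ = θ / 4`, in total `θ / 2 < θ`; `J = 1 + 2n` bounds the sum of the component norms by the
  -- Sobolev norm.
  refine isClosed_setOfPred_isCompactOperator.closure_subset (Metric.mem_closure_iff.2 fun θ hθ => ?_)
  set J : NNReal := 1 + (Fintype.card (Fin n ⊕ Fin n) : NNReal) with hJ
  have hJ0 : 0 < J := by positivity
  set κ : NNReal := θ.toNNReal / 4 with hκ
  have hκ0 : 0 < κ := by
    have := Real.toNNReal_pos.2 hθ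
    positivity
  -- Chosen so that `C J ≤ N κ`, which makes the tail at most `κ ‖h‖`; the `+ 1` makes `N` nonzero
  -- for the division.
  set N : NNReal := C * J / κ + 1 with hN
  obtain ⟨r, hr⟩ := hC N
  obtain ⟨P, hPc, hP⟩ := exists_compact_approx hφ η r (κ := κ / J) (by positivity)
  refine ⟨P.comp (embedding hφ η), hPc.comp_clm (embedding hφ η), ?_⟩
  have hbound : ∀ h : W1 hφ η, ‖(embedding hφ η - P.comp (embedding hφ η)) h‖ₑ
      ≤ (2 * κ : NNReal) * ‖h‖ₑ := by
    intro h
    have hS : ‖inclₗ hφ η h‖ₑ + ∑ j, ‖twistedD hφ η j h‖ₑ ≤ J * ‖h‖ₑ := by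
      calc _ ≤ ‖h‖ₑ + ∑ j : Fin n ⊕ Fin n, ‖h‖ₑ :=
            add_le_add (enorm_inclₗ_le hφ η h)
              (Finset.sum_le_sum fun j _ => enorm_twistedD_le hφ η j h)
        _ = _ := by
            rw [Finset.sum_const, Finset.card_univ, nsmul_eq_mul, hJ, ENNReal.coe_add,
              ENNReal.coe_one, ENNReal.coe_natCast]
            ring
    have h1 := hr _ _ fun j => twistedD_spec hφ η j h
    have h2 := hP _ _ fun j => twistedD_spec hφ η j h
    simp only [← Lp.enorm_def] at h1
    have h3 : eLpNorm (inclₗ hφ η h) 2 ((weight φ).restrict (Metric.closedBall 0 r)ᶜ)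
        ≤ κ * ‖h‖ₑ := by
      have hN0 : (N : ENNReal) ≠ 0 := by
        have : N ≠ 0 := by positivity
        exact_mod_cast this
      rw [← ENNReal.mul_le_mul_iff_right hN0 ENNReal.coe_ne_top]
      refine h1.trans ((mul_le_mul_right hS _).trans ?_)
      rw [← mul_assoc, ← mul_assoc, ← ENNReal.coe_mul, ← ENNReal.coe_mul]
      gcongr ?_ * _
      rw [ENNReal.coe_le_coe, hN, add_mul, div_mul_cancel₀ _ hκ0.ne']
      exact le_self_add
    calc _ ≤ _ := h2
      _ ≤ (κ / J : NNReal) * (J * ‖h‖ₑ) + κ * ‖h‖ₑ := by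
          gcongr
      _ = _ := by
          rw [← mul_assoc, ← ENNReal.coe_mul, div_mul_cancel₀ _ hJ0.ne']
          push_cast
          ring
  rw [dist_eq_norm]
  refine (ContinuousLinearMap.opNorm_le_bound _ (2 * κ : NNReal).coe_nonneg fun h => ?_).trans_lt
    (b := ((2 * κ : NNReal) : ℝ)) ?_
  · have := ENNReal.toReal_mono (by finiteness) (hbound h)
    rwa [ENNReal.toReal_mul, toReal_enorm, toReal_enorm, ENNReal.coe_toReal] at this
  · rw [hκ]
    push_cast
    rw [Real.coe_toNNReal _ hθ.le]
    linarith

end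

theorem theorem2 (n : ℕ) (φ : WeightedSobolev.Cn n → ℝ) (hφ : ContDiff ℝ 2 φ) (η : ℝ)
    (hlim : ∃ ε : ℝ, 0 < ε ∧
      Tendsto (fun z => η ^ 2 * WeightedSobolev.gradSq φ z + (1 + ε) * η * Δ φ z)
        (Bornology.cobounded (WeightedSobolev.Cn n)) atTop) :
    IsCompactOperator (WeightedSobolev.embedding hφ η) := by
  obtain ⟨ε, hε, hlim⟩ := hlim
  exact isCompactOperator_embedding_of_tendsto hφ hε hlim
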